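/- Theorem. Let $n\ge 2$ be an integer. For a real Banach space $X$ with unit sphere $S(X)$, the upper modified $n$-th von Neumann–Jordan constant $\overline{C}_{mNJ}^{(n)}(X)$ is the smallest constant $C>0$ such that $$\frac{\sum_{\theta_2,\dots,\theta_n=\pm1}\bigl\|x_1+\sum_{j=2}^n\theta_jx_j\bigr\|^2}{2^{n-1}\sum_{j=1}^n\|x_j\|^2}\le C\qquad\text{for all }x_1,\dots,x_n\in S(X).$$ Let $1\le p<\infty$ and let $X$ be the real space $L^p(\mu)$ for a measure $\mu$ on a measurable space, or the real space $l^p(I)$ for an index set $I$, finite or infinite (so $l^p$ and the finite-dimensional $l^p_k$ are included). Then $$\overline{C}_{mNJ}^{(n)}(X)=\begin{cases} n^{\frac2p-1} & \text{if } 1\le p\le 2 \text{ and } \dim X\ge n,\\[4pt] n^{-1}\Bigl(2^{1-n}\sum_{k=0}^{\lfloor n/2\rfloor}\binom nk (n-2k)^p\Bigr)^{2/p} & \text{if } 2<p<\infty \text{ and } \dim X\ge 2^{n-1}.\end{cases}$$ -/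

import Mathlib

open MeasureTheory
open scoped ENNReal

noncomputable section

/-- The quotient
`C⁽ⁿ⁾(x₁, …, xₙ) = (∑_{θ₂, …, θₙ = ±1} ‖x₁ + ∑_{j ≥ 2} θⱼ xⱼ‖²) / (2ⁿ⁻¹ ∑ⱼ ‖xⱼ‖²)`.
The vectors are indexed by `Fin n`, so that `x 0` is the first one, and the `2ⁿ⁻¹` choices of signs
are the functions from the nonzero indices to `ℤˣ = {1, -1}`. -/
def njQuotient (n : ℕ) [NeZero n] {X : Type*} [NormedAddCommGroup X] (x : Fin n → X) : ℝ :=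
  (∑ θ : {j : Fin n // j ≠ 0} → ℤˣ,
      ‖x 0 + ∑ j : {j : Fin n // j ≠ 0}, ((θ j : ℤˣ) : ℤ) • x j‖ ^ 2) /
    (2 ^ (n - 1) * ∑ j, ‖x j‖ ^ 2)

/-- The constants `C > 0` with `C⁽ⁿ⁾(x₁, …, xₙ) ≤ C` for all `x₁, …, xₙ` in the unit sphere. -/
def modifiedNJBounds (n : ℕ) [NeZero n] (X : Type*) [NormedAddCommGroup X] : Set ℝ :=
  {C : ℝ | 0 < C ∧ ∀ x : Fin n → X, (∀ j, x j ∈ Metric.sphere (0 : X) 1) → njQuotient n x ≤ C}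

/-- The upper modified `n`-th von Neumann-Jordan constant: the smallest element of
`modifiedNJBounds n X` (see `isLeast_upperModifiedNJ`). -/
def upperModifiedNJ (n : ℕ) [NeZero n] (X : Type*) [NormedAddCommGroup X] : ℝ :=
  sInf (modifiedNJBounds n X)

/-- On the unit sphere the quotient is at most `n`. -/
theorem njQuotient_le (n : ℕ) [NeZero n] {X : Type*} [NormedAddCommGroup X] (x : Fin n → X)
    (hx : ∀ j, x j ∈ Metric.sphere (0 : X) 1) : njQuotient n x ≤ n := by
  have hx' : ∀ j, ‖x j‖ = 1 := fun j => by simpa using hx j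
  have hn : (0 : ℝ) < n := by exact_mod_cast Nat.pos_of_ne_zero (NeZero.ne n)
  have hcard : Fintype.card {j : Fin n // j ≠ 0} = n - 1 := by
    simp [Fintype.card_subtype_compl]
  have hterm : ∀ θ : {j : Fin n // j ≠ 0} → ℤˣ,
      ‖x 0 + ∑ j : {j : Fin n // j ≠ 0}, ((θ j : ℤˣ) : ℤ) • x j‖ ^ 2 ≤ (n : ℝ) ^ 2 := by
    intro θ
    refine pow_le_pow_left₀ (norm_nonneg _) ?_ 2
    have h1 : ‖∑ j : {j : Fin n // j ≠ 0}, ((θ j : ℤˣ) : ℤ) • x j‖ ≤ ((n - 1 : ℕ) : ℝ) := by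
      refine (norm_sum_le _ _).trans ?_
      have : ∀ j : {j : Fin n // j ≠ 0}, ‖((θ j : ℤˣ) : ℤ) • x j‖ = 1 := by
        intro j
        rcases Int.units_eq_one_or (θ j) with h | h <;> simp [h, hx']
      rw [Finset.sum_congr rfl fun j _ => this j]
      simp
    have h2 := norm_add_le (x 0) (∑ j : {j : Fin n // j ≠ 0}, ((θ j : ℤˣ) : ℤ) • x j)
    have h3 : ((n - 1 : ℕ) : ℝ) = n - 1 := by
      have := Nat.pos_of_ne_zero (NeZero.ne n)
      push_cast [Nat.cast_sub this]
      ring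
    rw [hx' 0] at h2
    linarith
  have hsum := Finset.sum_le_sum fun θ (_ : θ ∈ Finset.univ) => hterm θ
  have hden : ∑ j, ‖x j‖ ^ 2 = n := by simp [hx']
  unfold njQuotient
  rw [hden, div_le_iff₀ (by positivity)]
  refine hsum.trans (le_of_eq ?_)
  rw [Finset.sum_const, Finset.card_univ, Fintype.card_fun, hcard, Fintype.card_units_int,
    nsmul_eq_mul]
  push_cast
  ring

/-- On a nontrivial space the infimum that defines the constant is attained. -/
theorem isLeast_upperModifiedNJ (n : ℕ) [NeZero n] (X : Type*) [NormedAddCommGroup X]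
    [NormedSpace ℝ X] [Nontrivial X] :
    IsLeast (modifiedNJBounds n X) (upperModifiedNJ n X) := by
  have hn : (0 : ℝ) < n := by exact_mod_cast Nat.pos_of_ne_zero (NeZero.ne n)
  have hne : (modifiedNJBounds n X).Nonempty := ⟨n, hn, fun x hx => njQuotient_le n x hx⟩
  have hbdd : BddBelow (modifiedNJBounds n X) := ⟨0, fun C hC => hC.1.le⟩
  have hle : ∀ x : Fin n → X, (∀ j, x j ∈ Metric.sphere (0 : X) 1) →
      njQuotient n x ≤ upperModifiedNJ n X :=
    fun x hx => le_csInf hne fun C hC => hC.2 x hx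
  obtain ⟨u, hu⟩ := exists_norm_eq X (zero_le_one' ℝ)
  have hpos : 0 < njQuotient n (fun _ => u) := by
    unfold njQuotient
    refine div_pos ?_ (by simp only [hu]; simp; exact Nat.pos_of_ne_zero (NeZero.ne n))
    refine Finset.sum_pos' (fun _ _ => by positivity) ⟨fun _ => 1, Finset.mem_univ _, ?_⟩
    have hc : Fintype.card {j : Fin n // j ≠ 0} = n - 1 := by
      simp [Fintype.card_subtype_compl]
    have : u + ∑ _j : {j : Fin n // j ≠ 0}, (((1 : ℤˣ) : ℤ)) • u = (n : ℝ) • u := by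
      have h1 := Nat.sub_add_cancel (Nat.pos_of_ne_zero (NeZero.ne n))
      rw [Finset.sum_const, Finset.card_univ, hc]
      simp only [Units.val_one, one_smul]
      rw [← succ_nsmul', h1, Nat.cast_smul_eq_nsmul]
    rw [this, norm_smul, hu]
    simp
    positivity
  exact ⟨⟨hpos.trans_le (hle _ fun _ => by simp [hu]), hle⟩, fun C hC => csInf_le hbdd hC⟩

end

/-! Since the norm is even, on unit vectors the quotient is `1/n` times the mean of `‖∑ εⱼ xⱼ‖²`
over all `2ⁿ` sign vectors. Upper bounds come from inequalities between real numbers, integrated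
over `Ω`. Equality is reached on an isometric copy of a finite-dimensional `ℓᵖ`, by unit vectors all
of whose signed sums have the same norm.

For `p ≤ 2` the scalar input is orthogonality of signs together with `(∑ aⱼ²)^(p/2) ≤ ∑ |aⱼ|^p`. A
weighted Hölder argument turns it into a bound on second moments of norms
(`Lp_sum_signs_norm_sq_le`). The unit vectors of `ℓᵖ` of dimension `n` are extremal.

For `p > 2` the scalar input is `rademacherPowSum_le`: for fixed `∑ |aⱼ|^p`, the sum of `|∑ εⱼ
aⱼ|^p` over the signs is largest when all `|aⱼ|` agree. Moving `p`-th powers between two coordinates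
towards each other increases the sum; with the other signs frozen this is a one-variable
monotonicity (`antitoneOn_signedPowSum`), and the sign of the derivative is a convexity inequality
split into three ranges. After integration, the power mean inequality passes from `p`-th to second
moments. Rademacher sign patterns on `2ⁿ⁻¹` coordinates are extremal.

The dimension hypothesis supplies the copy of `ℓᵖ`: in `Lᵖ(μ)` it forces enough disjoint sets of
positive finite measure. The space `ℓᵖ(ι)` sits isometrically in `Lᵖ` of the counting measure and
inherits its upper bounds. -/

/-! ### Convexity inequalities for powers -/

/-- Two-point Karamata inequality for powers. -/
theorem rpow_add_rpow_le_of_add_eq {q x y z w : ℝ} (hq : 1 ≤ q) (hx : 0 ≤ x) (hz : x ≤ z)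
    (hw : x ≤ w) (h : x + y = z + w) : z ^ q + w ^ q ≤ x ^ q + y ^ q := by
  rcases eq_or_lt_of_le (show x ≤ y by linarith) with hxy | hxy
  · obtain rfl : z = x := by linarith
    obtain rfl : w = y := by linarith
    exact le_rfl
  have hc := convexOn_rpow hq
  have hd : 0 < y - x := by linarith
  have key : ∀ t, x ≤ t → t ≤ y → t ^ q ≤ (y - t) / (y - x) * x ^ q + (t - x) / (y - x) * y ^ q := by
    intro t h1 h2
    have := hc.2 (show x ∈ Set.Ici 0 from hx) (show y ∈ Set.Ici (0 : ℝ) from by simp; linarith)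
      (div_nonneg (sub_nonneg.2 h2) hd.le) (div_nonneg (sub_nonneg.2 h1) hd.le)
      (by field_simp; ring)
    simp only [smul_eq_mul] at this
    rwa [show (y - t) / (y - x) * x + (t - x) / (y - x) * y = t by field_simp; ring] at this
  have h1 := key z hz (by linarith)
  have h2 := key w hw (by linarith)
  have : (y - z) / (y - x) * x ^ q + (z - x) / (y - x) * y ^ q +
      ((y - w) / (y - x) * x ^ q + (w - x) / (y - x) * y ^ q) = x ^ q + y ^ q := by
    obtain rfl : w = x + y - z := by linarith
    field_simp
    ring
  linarith

theorem rpow_add_rpow_le_rpow_of_add_eq {q z w y : ℝ} (hq : 1 ≤ q) (hz : 0 ≤ z) (hw : 0 ≤ w)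
    (h : z + w = y) : z ^ q + w ^ q ≤ y ^ q := by
  have := rpow_add_rpow_le_of_add_eq hq le_rfl hz hw (show 0 + y = z + w by linarith)
  rwa [Real.zero_rpow (by linarith), zero_add] at this

/-- Superadditivity of `x ^ q`, used three times with `2 * v` as the intermediate factor. This and
the next two lemmas are the cases `c ≤ v`, `v ≤ c ≤ u`, `u ≤ c` of `signedPowSum_deriv_ineq`, with
`u = a + b`, `v = a - b`, `q = p - 1`. -/
theorem sign_ineq_small {q u v c : ℝ} (hq : 1 ≤ q) (hc : 0 ≤ c) (hcv : c ≤ v) (hvu : v ≤ u) :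
    ((v + c) ^ q + (v - c) ^ q) * ((u + v) ^ q + (u - v) ^ q) ≤
      ((u + c) ^ q + (u - c) ^ q) * ((u + v) ^ q - (u - v) ^ q) := by
  have h1 : (u - v) ^ q + (2 * v) ^ q ≤ (u + v) ^ q :=
    rpow_add_rpow_le_rpow_of_add_eq hq (by linarith) (by linarith) (by ring)
  have h2 : ((v + c) * (u + v)) ^ q + ((v - c) * (u - v)) ^ q ≤ (2 * v * (u + c)) ^ q :=
    rpow_add_rpow_le_rpow_of_add_eq hq (mul_nonneg (by linarith) (by linarith))
      (mul_nonneg (by linarith) (by linarith)) (by ring)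
  have h3 : ((v + c) * (u - v)) ^ q + ((v - c) * (u + v)) ^ q ≤ (2 * v * (u - c)) ^ q :=
    rpow_add_rpow_le_rpow_of_add_eq hq (mul_nonneg (by linarith) (by linarith))
      (mul_nonneg (by linarith) (by linarith)) (by ring)
  rw [Real.mul_rpow (by linarith) (by linarith), Real.mul_rpow (by linarith) (by linarith),
    Real.mul_rpow (x := 2 * v) (by linarith) (by linarith)] at h2 h3
  have h4 : 0 ≤ (u + c) ^ q + (u - c) ^ q :=
    add_nonneg (Real.rpow_nonneg (by linarith) _) (Real.rpow_nonneg (by linarith) _)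
  have h5 := mul_le_mul_of_nonneg_left (show (2 * v) ^ q ≤ (u + v) ^ q - (u - v) ^ q by linarith) h4
  linarith

/-- A product of two comparisons: the increment of a convex function over an interval of length `2 *
v` grows as its centre moves from `c` to `u`, and a symmetric sum about `u` grows with the spread.
-/
theorem sign_ineq_middle {q u v c : ℝ} (hq : 1 ≤ q) (hv : 0 ≤ v) (hvc : v ≤ c) (hcu : c ≤ u) :
    ((c + v) ^ q - (c - v) ^ q) * ((u + v) ^ q + (u - v) ^ q) ≤
      ((u + c) ^ q + (u - c) ^ q) * ((u + v) ^ q - (u - v) ^ q) := by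
  have h1 : (c + v) ^ q + (u - v) ^ q ≤ (c - v) ^ q + (u + v) ^ q :=
    rpow_add_rpow_le_of_add_eq hq (by linarith) (by linarith) (by linarith) (by ring)
  have h2 : (u + v) ^ q + (u - v) ^ q ≤ (u - c) ^ q + (u + c) ^ q :=
    rpow_add_rpow_le_of_add_eq hq (by linarith) (by linarith) (by linarith) (by ring)
  have h3 : (c - v) ^ q ≤ (c + v) ^ q :=
    Real.rpow_le_rpow (by linarith) (by linarith) (by linarith)
  have h4 : 0 ≤ (u + v) ^ q + (u - v) ^ q :=
    add_nonneg (Real.rpow_nonneg (by linarith) _) (Real.rpow_nonneg (by linarith) _)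
  rw [mul_comm]
  exact mul_le_mul (by linarith) (by linarith) (by linarith) (by linarith)

/-- Expanded, this compares two quadruples of products with the common total `4 * c * u`; the right
one is more spread out, so two-point Karamata steps suffice. -/
theorem sign_ineq_large {q u v c : ℝ} (hq : 1 ≤ q) (hv : 0 ≤ v) (hvu : v ≤ u) (huc : u ≤ c) :
    ((c + v) ^ q - (c - v) ^ q) * ((u + v) ^ q + (u - v) ^ q) ≤
      ((c + u) ^ q - (c - u) ^ q) * ((u + v) ^ q - (u - v) ^ q) := by
  have e : ∀ {x y : ℝ}, 0 ≤ x → 0 ≤ y → x ^ q * y ^ q = (x * y) ^ q :=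
    fun hx hy => (Real.mul_rpow hx hy).symm
  have a1 : 0 ≤ c + v := by linarith
  have a2 : 0 ≤ c - v := by linarith
  have a3 : 0 ≤ c + u := by linarith
  have a4 : 0 ≤ c - u := by linarith
  have a5 : 0 ≤ u + v := by linarith
  have a6 : 0 ≤ u - v := by linarith
  suffices h : ((c + v) * (u + v)) ^ q + ((c + v) * (u - v)) ^ q + ((c + u) * (u - v)) ^ q +
      ((c - u) * (u + v)) ^ q ≤ ((c + u) * (u + v)) ^ q + ((c - u) * (u - v)) ^ q +
      ((c - v) * (u + v)) ^ q + ((c - v) * (u - v)) ^ q by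
    rw [← e a1 a5, ← e a1 a6, ← e a3 a6, ← e a4 a5, ← e a3 a5, ← e a4 a6, ← e a2 a5,
      ← e a2 a6] at h
    linarith
  have hL4 : 0 ≤ (c - u) * (u - v) := mul_nonneg a4 a6
  -- The quantity `d = u ^ 2 + v ^ 2 - 2 * c * v` equals both `(c - v) * (u - v) - (c - u) * (u +
  -- v)` and `(c + u) * (u - v) - (c - v) * (u + v)`. If `d ≤ 0`, the quadruples compare in pairs;
  -- otherwise `d` is shifted between the extreme terms to get an intermediate quadruple.
  rcases le_total (u ^ 2 + v ^ 2) (2 * c * v) with hd | hd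
  · have h1 : ((c + v) * (u + v)) ^ q + ((c + v) * (u - v)) ^ q ≤
        ((c - u) * (u - v)) ^ q + ((c + u) * (u + v)) ^ q :=
      rpow_add_rpow_le_of_add_eq hq hL4 (by nlinarith) (by nlinarith) (by ring)
    have h2 : ((c + u) * (u - v)) ^ q + ((c - u) * (u + v)) ^ q ≤
        ((c - v) * (u - v)) ^ q + ((c - v) * (u + v)) ^ q :=
      rpow_add_rpow_le_of_add_eq hq (mul_nonneg a2 a6) (by nlinarith) (by nlinarith) (by ring)
    linarith
  · have h1 : ((c - u) * (u + v)) ^ q + ((c - u) * (u - v) + (u ^ 2 + v ^ 2 - 2 * c * v)) ^ q ≤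
        ((c - u) * (u - v)) ^ q + ((c - v) * (u - v)) ^ q :=
      rpow_add_rpow_le_of_add_eq hq hL4 (by nlinarith) (by nlinarith) (by ring)
    have h2 : ((c + u) * (u + v) - (u ^ 2 + v ^ 2 - 2 * c * v)) ^ q + ((c + u) * (u - v)) ^ q ≤
        ((c - v) * (u + v)) ^ q + ((c + u) * (u + v)) ^ q :=
      rpow_add_rpow_le_of_add_eq hq (mul_nonneg a2 a5) (by nlinarith) (by nlinarith) (by ring)
    have h3 : ((c + v) * (u + v)) ^ q + ((c + v) * (u - v)) ^ q ≤
        ((c - u) * (u - v) + (u ^ 2 + v ^ 2 - 2 * c * v)) ^ q +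
        ((c + u) * (u + v) - (u ^ 2 + v ^ 2 - 2 * c * v)) ^ q :=
      rpow_add_rpow_le_of_add_eq hq (by nlinarith) (by nlinarith) (by nlinarith) (by ring)
    linarith

theorem abs_rpow_sub_two_mul_of_nonneg {p x : ℝ} (hp : 1 < p) (hx : 0 ≤ x) :
    |x| ^ (p - 2) * x = x ^ (p - 1) := by
  rcases hx.eq_or_lt with rfl | hx
  · rw [Real.zero_rpow (by linarith), mul_zero]
  · rw [abs_of_pos hx, ← Real.rpow_add_one hx.ne']
    congr 1
    ring

theorem abs_rpow_sub_two_mul_neg (p x : ℝ) : |-x| ^ (p - 2) * -x = -(|x| ^ (p - 2) * x) := by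
  rw [abs_neg]
  ring

/-! ### Two coordinates: transfer of `p`-th powers -/

/-- The sum of `|c ± a ± b| ^ p` over all signs. -/
noncomputable def signedPowSum (p c a b : ℝ) : ℝ :=
  |c + a + b| ^ p + |c + a - b| ^ p + |c - a + b| ^ p + |c - a - b| ^ p

theorem signedPowSum_comm (p c a b : ℝ) : signedPowSum p c a b = signedPowSum p c b a := by
  unfold signedPowSum
  rw [show c + b + a = c + a + b by ring, show c + b - a = c - a + b by ring,
    show c - b + a = c + a - b by ring, show c - b - a = c - a - b by ring]
  ring

theorem signedPowSum_neg (p c a b : ℝ) : signedPowSum p (-c) a b = signedPowSum p c a b := by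
  unfold signedPowSum
  rw [show -c + a + b = -(c - a - b) by ring, show -c + a - b = -(c - a + b) by ring,
    show -c - a + b = -(c + a - b) by ring, show -c - a - b = -(c + a + b) by ring]
  simp only [abs_neg]
  ring

theorem signedPowSum_abs (p c a b : ℝ) : signedPowSum p |c| a b = signedPowSum p c a b := by
  rcases abs_choice c with h | h <;> rw [h]
  exact signedPowSum_neg p c a b

/-- The sign of the derivative of `signedPowSum` along transfers of `p`-th powers. -/
theorem signedPowSum_deriv_ineq {p c a b : ℝ} (hp : 2 ≤ p) (hc : 0 ≤ c) (hb : 0 ≤ b)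
    (hab : b ≤ a) {s : ℝ → ℝ} (hs : s = fun x => |x| ^ (p - 2) * x) :
    (s (c + a + b) + s (c + a - b) - s (c - a + b) - s (c - a - b)) * b ^ (p - 1) ≤
      (s (c + a + b) - s (c + a - b) + s (c - a + b) - s (c - a - b)) * a ^ (p - 1) := by
  have hpos : ∀ {x}, 0 ≤ x → s x = x ^ (p - 1) := by
    intro x hx
    rw [hs]
    exact abs_rpow_sub_two_mul_of_nonneg (by linarith) hx
  have hneg : ∀ x, s (-x) = -s x := by
    intro x
    rw [hs]
    exact abs_rpow_sub_two_mul_neg p x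
  have hq : 1 ≤ p - 1 := by linarith
  have h2 : (0 : ℝ) < 2 ^ (p - 1) := by positivity
  have e1 : ((a + b) + (a - b)) ^ (p - 1) = 2 ^ (p - 1) * a ^ (p - 1) := by
    rw [← Real.mul_rpow (by norm_num) (by linarith)]
    ring_nf
  have e2 : ((a + b) - (a - b)) ^ (p - 1) = 2 ^ (p - 1) * b ^ (p - 1) := by
    rw [← Real.mul_rpow (by norm_num) hb]
    ring_nf
  -- With `u = a + b` and `v = a - b` one has `2 * a = u + v` and `2 * b = u - v`; collecting the
  -- terms in `u` and in `v` gives the form of the three sign inequalities.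
  have key : (s (c + (a - b)) - s (c - (a - b))) *
        (((a + b) + (a - b)) ^ (p - 1) + ((a + b) - (a - b)) ^ (p - 1)) ≤
      (s (c + (a + b)) - s (c - (a + b))) *
        (((a + b) + (a - b)) ^ (p - 1) - ((a + b) - (a - b)) ^ (p - 1)) := by
    rcases le_total c (a - b) with h | h
    · rw [show c - (a - b) = -((a - b) - c) by ring, show c - (a + b) = -((a + b) - c) by ring,
        hneg, hneg, hpos (by linarith), hpos (by linarith), hpos (by linarith),
        hpos (by linarith), sub_neg_eq_add, sub_neg_eq_add, add_comm c, add_comm c]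
      exact sign_ineq_small hq hc h (by linarith)
    rcases le_total c (a + b) with h' | h'
    · rw [show c - (a + b) = -((a + b) - c) by ring,
        hneg, hpos (by linarith), hpos (by linarith), hpos (by linarith),
        hpos (by linarith), sub_neg_eq_add, add_comm c (a + b)]
      exact sign_ineq_middle hq (by linarith) h h'
    · rw [hpos (by linarith), hpos (by linarith), hpos (by linarith), hpos (by linarith)]
      exact sign_ineq_large hq (by linarith) (by linarith) h'
  rw [e1, e2, ← mul_add, ← mul_sub] at key
  rw [show c + a + b = c + (a + b) by ring, show c + a - b = c + (a - b) by ring,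
    show c - a + b = c - (a - b) by ring, show c - a - b = c - (a + b) by ring]
  refine le_of_mul_le_mul_left ?_ h2
  linarith

/-- The parameter is half the gap between the `p`-th powers, whose total stays `2 * M`.
Differentiating, with `da/dt = a ^ (1 - p) / p` and `db/dt = -b ^ (1 - p) / p`, leads to
`signedPowSum_deriv_ineq`. Only the interior is differentiated, because the root `(M - t) ^ (1 / p)`
is singular at `t = M`. -/
theorem antitoneOn_signedPowSum {p c M : ℝ} (hp : 2 ≤ p) (hc : 0 ≤ c) :
    AntitoneOn (fun t => signedPowSum p c ((M + t) ^ (1 / p)) ((M - t) ^ (1 / p)))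
      (Set.Icc 0 M) := by
  have hp0 : 0 < p := by linarith
  have hp1 : 0 < 1 / p := by positivity
  set s : ℝ → ℝ := fun x => |x| ^ (p - 2) * x with hs
  have hda : ∀ x, HasDerivAt (fun x : ℝ => |x| ^ p) (p * s x) x := by
    intro x
    have := hasDerivAt_abs_rpow x (show 1 < p by linarith)
    rwa [mul_assoc] at this
  apply antitoneOn_of_hasDerivWithinAt_nonpos (convex_Icc 0 M)
    (f' := fun t =>
      let a := (M + t) ^ (1 / p)
      let b := (M - t) ^ (1 / p)
      let a' := 1 / p * (M + t) ^ (1 / p - 1)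
      let b' := 1 / p * (M - t) ^ (1 / p - 1)
      p * s (c + a + b) * (a' - b') + p * s (c + a - b) * (a' + b') +
        p * s (c - a + b) * (-a' - b') + p * s (c - a - b) * (-a' + b'))
  · have h1 : Continuous fun t : ℝ => (M + t) ^ (1 / p) :=
      (Real.continuous_rpow_const hp1.le).comp (by fun_prop)
    have h2 : Continuous fun t : ℝ => (M - t) ^ (1 / p) :=
      (Real.continuous_rpow_const hp1.le).comp (by fun_prop)
    have h3 : Continuous fun x : ℝ => |x| ^ p :=
      (Real.continuous_rpow_const hp0.le).comp (by fun_prop)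
    unfold signedPowSum
    refine Continuous.continuousOn ?_
    exact (((h3.comp ((continuous_const.add h1).add h2)).add
      (h3.comp ((continuous_const.add h1).sub h2))).add
      (h3.comp ((continuous_const.sub h1).add h2))).add
      (h3.comp ((continuous_const.sub h1).sub h2))
  · intro t ht
    rw [interior_Icc] at ht
    have ha : HasDerivAt (fun t : ℝ => (M + t) ^ (1 / p)) (1 / p * (M + t) ^ (1 / p - 1)) t := by
      have := ((hasDerivAt_id t).const_add M).rpow_const (p := 1 / p)
        (Or.inl (by simp; linarith [ht.1, ht.2]))
      simpa [mul_comm] using this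
    have hb : HasDerivAt (fun t : ℝ => (M - t) ^ (1 / p)) (-(1 / p * (M - t) ^ (1 / p - 1))) t := by
      have := ((hasDerivAt_id t).const_sub M).rpow_const (p := 1 / p)
        (Or.inl (by simp; linarith [ht.1, ht.2]))
      simpa [mul_comm] using this
    have d1 := (hda _).comp t ((ha.const_add c).add hb)
    have d2 := (hda _).comp t ((ha.const_add c).sub hb)
    have d3 := (hda _).comp t ((ha.const_sub c).add hb)
    have d4 := (hda _).comp t ((ha.const_sub c).sub hb)
    refine (HasDerivAt.congr_deriv (((d1.add d2).add d3).add d4) ?_).hasDerivWithinAt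
    simp only [Pi.add_apply, Pi.sub_apply]
    ring
  · intro t ht
    rw [interior_Icc] at ht
    have hx : 0 < M + t := by linarith [ht.1, ht.2]
    have hy : 0 < M - t := by linarith [ht.1, ht.2]
    have hb : 0 < (M - t) ^ (1 / p) := Real.rpow_pos_of_pos hy _
    have ha : 0 < (M + t) ^ (1 / p) := Real.rpow_pos_of_pos hx _
    have key := signedPowSum_deriv_ineq hp hc hb.le
      (Real.rpow_le_rpow hy.le (show M - t ≤ M + t by linarith [ht.1]) hp1.le) hs
    have ea : ∀ {z : ℝ}, 0 < z → z ^ (1 / p - 1) * (z ^ (1 / p)) ^ (p - 1) = 1 := by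
      intro z hz
      rw [← Real.rpow_mul hz.le, ← Real.rpow_add hz]
      rw [show 1 / p - 1 + 1 / p * (p - 1) = 0 by field_simp; ring, Real.rpow_zero]
    have ha' : 0 < (M + t) ^ (1 / p - 1) := Real.rpow_pos_of_pos hx _
    have hb' : 0 < (M - t) ^ (1 / p - 1) := Real.rpow_pos_of_pos hy _
    -- By `ea`, the factors `a ^ (p - 1)` and `b ^ (p - 1)` are inverse to the two derivative
    -- factors, so this multiplication cancels them.
    have k2 := mul_le_mul_of_nonneg_right key (mul_pos ha' hb').le
    have e1 := ea hx
    have e2 := ea hy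
    dsimp only
    generalize s (c + (M + t) ^ (1 / p) + (M - t) ^ (1 / p)) = s1 at *
    generalize s (c + (M + t) ^ (1 / p) - (M - t) ^ (1 / p)) = s2 at *
    generalize s (c - (M + t) ^ (1 / p) + (M - t) ^ (1 / p)) = s3 at *
    generalize s (c - (M + t) ^ (1 / p) - (M - t) ^ (1 / p)) = s4 at *
    generalize (M + t) ^ (1 / p - 1) = a' at *
    generalize (M - t) ^ (1 / p - 1) = b' at *
    generalize ((M + t) ^ (1 / p)) ^ (p - 1) = A at *
    generalize ((M - t) ^ (1 / p)) ^ (p - 1) = B at *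
    have k3 : (s1 + s2 - s3 - s4) * a' ≤ (s1 - s2 + s3 - s4) * b' := by
      calc (s1 + s2 - s3 - s4) * a' = (s1 + s2 - s3 - s4) * B * (a' * b') := by
            linear_combination (-(s1 + s2 - s3 - s4) * a') * e2
        _ ≤ _ := k2
        _ = _ := by linear_combination ((s1 - s2 + s3 - s4) * b') * e1
    have : p * s1 * (1 / p * a' - 1 / p * b') + p * s2 * (1 / p * a' + 1 / p * b') +
        p * s3 * (-(1 / p * a') - 1 / p * b') + p * s4 * (-(1 / p * a') + 1 / p * b') =
        (s1 + s2 - s3 - s4) * a' - (s1 - s2 + s3 - s4) * b' := by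
      field_simp
      ring
    rw [this]
    linarith

/-- Transferring `p`-th powers between two coordinates towards each other does not decrease the
sum over the signs. -/
theorem signedPowSum_le {p : ℝ} (hp : 2 ≤ p) (c : ℝ) {a b a' b' : ℝ} (ha : 0 ≤ a) (hb : 0 ≤ b)
    (ha' : 0 ≤ a') (hb' : 0 ≤ b') (h : a ^ p + b ^ p = a' ^ p + b' ^ p) (h1 : b ^ p ≤ a' ^ p)
    (h2 : b ^ p ≤ b' ^ p) : signedPowSum p c a b ≤ signedPowSum p c a' b' := by
  wlog hw : b' ^ p ≤ a' ^ p generalizing a' b'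
  · rw [signedPowSum_comm p c a']
    exact this hb' ha' (by linarith) h2 h1 (by linarith)
  rw [← signedPowSum_abs p c a, ← signedPowSum_abs p c a']
  have hB : 0 ≤ b ^ p := Real.rpow_nonneg hb _
  have hp0 : p ≠ 0 := by linarith
  -- Both pairs lie on the same curve, at parameter first `p`-th power minus mean; `h2` orders the
  -- parameters and `hw` makes the smaller one nonnegative.
  have key := antitoneOn_signedPowSum (M := (a ^ p + b ^ p) / 2) hp (abs_nonneg c)
    (a := a' ^ p - (a ^ p + b ^ p) / 2) (b := a ^ p - (a ^ p + b ^ p) / 2)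
    ⟨by linarith, by linarith⟩ ⟨by linarith, by linarith⟩ (by linarith)
  dsimp only at key
  have e : ∀ {z : ℝ}, 0 ≤ z → (z ^ p) ^ (1 / p) = z := by
    intro z hz
    rw [one_div, Real.rpow_rpow_inv hz hp0]
  rw [show (a ^ p + b ^ p) / 2 + (a ^ p - (a ^ p + b ^ p) / 2) = a ^ p by ring,
    show (a ^ p + b ^ p) / 2 - (a ^ p - (a ^ p + b ^ p) / 2) = b ^ p by ring,
    show (a ^ p + b ^ p) / 2 + (a' ^ p - (a ^ p + b ^ p) / 2) = a' ^ p by ring,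
    show (a ^ p + b ^ p) / 2 - (a' ^ p - (a ^ p + b ^ p) / 2) = b' ^ p by linarith,
    e ha, e hb, e ha', e hb'] at key
  exact key

/-! ### Sums over signs and their maximum -/

section SignSums

variable {ι : Type*} [Fintype ι] [DecidableEq ι]

/-- The sum of `|∑ j, ε j * a j| ^ p` over all signs `ε`. -/
noncomputable def rademacherPowSum (p : ℝ) (a : ι → ℝ) : ℝ :=
  ∑ ε : ι → ℤˣ, |∑ j, ((ε j : ℤ) : ℝ) * a j| ^ p

theorem rademacherPowSum_abs (p : ℝ) (a : ι → ℝ) :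
    rademacherPowSum p (fun j => |a j|) = rademacherPowSum p a := by
  have h : ∀ j, ∃ σ : ℤˣ, |a j| = ((σ : ℤ) : ℝ) * a j := by
    intro j
    rcases abs_choice (a j) with h | h
    · exact ⟨1, by simp [h]⟩
    · exact ⟨-1, by simp [h]⟩
  choose σ hσ using h
  unfold rademacherPowSum
  refine Fintype.sum_equiv (Equiv.mulRight σ) _ _ fun ε => ?_
  simp [hσ, mul_assoc]

theorem sum_signs_mul (Φ : (ι → ℤˣ) → ℝ) (σ : ι → ℤˣ) :
    ∑ ε, Φ (ε * σ) = ∑ ε, Φ ε :=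
  Fintype.sum_equiv (Equiv.mulRight σ) _ _ fun _ => rfl

/-- Flipping `ε i`, `ε k` or both permutes the sign vectors and leaves the remaining part of the sum
alone. Adding the four versions isolates the dependence on `a i` and `a k`. -/
theorem four_mul_rademacherPowSum (p : ℝ) (a : ι → ℝ) {i k : ι} (hik : i ≠ k) :
    4 * rademacherPowSum p a = ∑ ε : ι → ℤˣ,
      signedPowSum p (∑ j ∈ (Finset.univ.erase i).erase k, ((ε j : ℤ) : ℝ) * a j) (a i) (a k) := by
  have hsplit : ∀ ε : ι → ℤˣ, ∑ j, ((ε j : ℤ) : ℝ) * a j =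
      ∑ j ∈ (Finset.univ.erase i).erase k, ((ε j : ℤ) : ℝ) * a j +
        ((ε i : ℤ) : ℝ) * a i + ((ε k : ℤ) : ℝ) * a k := by
    intro ε
    rw [← Finset.sum_erase_add _ _ (Finset.mem_univ i),
      ← Finset.sum_erase_add _ _ (show k ∈ Finset.univ.erase i by simp [hik.symm])]
    ring
  have hc : ∀ (ε σ : ι → ℤˣ), (∀ j, j ≠ i → j ≠ k → σ j = 1) →
      ∑ j ∈ (Finset.univ.erase i).erase k, (((ε * σ) j : ℤ) : ℝ) * a j =
      ∑ j ∈ (Finset.univ.erase i).erase k, ((ε j : ℤ) : ℝ) * a j := by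
    intro ε σ h
    refine Finset.sum_congr rfl fun j hj => ?_
    simp only [Finset.mem_erase, Finset.mem_univ, and_true] at hj
    simp [h j hj.2 hj.1]
  unfold rademacherPowSum
  simp only [hsplit]
  set Φ : (ι → ℤˣ) → ℝ := fun ε => |∑ j ∈ (Finset.univ.erase i).erase k, ((ε j : ℤ) : ℝ) * a j +
        ((ε i : ℤ) : ℝ) * a i + ((ε k : ℤ) : ℝ) * a k| ^ p with hΦ
  obtain ⟨δ, m0, m1⟩ : ∃ δ : ι → ι → ℤˣ, (∀ l, δ l l = -1) ∧ ∀ l j, j ≠ l → δ l j = 1 :=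
    ⟨fun l => Pi.mulSingle l (-1), fun l => by simp, fun l j h => by simp [h]⟩
  calc 4 * ∑ ε, Φ ε = ∑ ε, Φ ε + ∑ ε, Φ (ε * δ k) + ∑ ε, Φ (ε * δ i) +
        ∑ ε, Φ (ε * (δ i * δ k)) := by
        simp only [sum_signs_mul]
        ring
    _ = _ := by
        rw [← Finset.sum_add_distrib, ← Finset.sum_add_distrib, ← Finset.sum_add_distrib]
        refine Finset.sum_congr rfl fun ε _ => ?_
        simp only [hΦ]
        rw [hc ε _ fun j h1 h2 => m1 k j h2, hc ε _ fun j h1 h2 => m1 i j h1,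
          hc ε _ fun j h1 h2 => by simp [m1 k j h2, m1 i j h1]]
        simp only [Pi.mul_apply, m1 _ _ hik, m1 _ _ hik.symm, m0]
        generalize ∑ j ∈ (Finset.univ.erase i).erase k, ((ε j : ℤ) : ℝ) * a j = c
        unfold signedPowSum
        rcases Int.units_eq_one_or (ε i) with h | h <;>
          rcases Int.units_eq_one_or (ε k) with h' | h' <;> rw [h, h'] <;>
          simp [← sub_eq_add_neg] <;> ring

theorem rademacherPowSum_le_of_transfer {p : ℝ} (hp : 2 ≤ p) {a a' : ι → ℝ} {i k : ι}
    (hik : i ≠ k) (hoff : ∀ j, j ≠ i → j ≠ k → a' j = a j) (hi : 0 ≤ a i) (hk : 0 ≤ a k)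
    (hi' : 0 ≤ a' i) (hk' : 0 ≤ a' k) (h : a i ^ p + a k ^ p = a' i ^ p + a' k ^ p)
    (h1 : a k ^ p ≤ a' i ^ p) (h2 : a k ^ p ≤ a' k ^ p) :
    rademacherPowSum p a ≤ rademacherPowSum p a' := by
  suffices 4 * rademacherPowSum p a ≤ 4 * rademacherPowSum p a' by linarith
  rw [four_mul_rademacherPowSum p a hik, four_mul_rademacherPowSum p a' hik]
  refine Finset.sum_le_sum fun ε _ => ?_
  have : ∑ j ∈ (Finset.univ.erase i).erase k, ((ε j : ℤ) : ℝ) * a' j =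
      ∑ j ∈ (Finset.univ.erase i).erase k, ((ε j : ℤ) : ℝ) * a j := by
    refine Finset.sum_congr rfl fun j hj => ?_
    simp only [Finset.mem_erase, Finset.mem_univ, and_true] at hj
    rw [hoff j hj.2 hj.1]
  rw [this]
  exact signedPowSum_le hp _ hi hk hi' hk' h h1 h2

/-- Among nonnegative vectors with prescribed sum of `p`-th powers, the constant one maximizes the
Rademacher sum. -/
theorem rademacherPowSum_le_const {p : ℝ} (hp : 2 ≤ p) {m : ℝ} (hm : 0 ≤ m) (a : ι → ℝ)
    (ha : ∀ j, 0 ≤ a j) (hsum : ∑ j, a j ^ p = ∑ _j : ι, m ^ p) :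
    rademacherPowSum p a ≤ rademacherPowSum p (fun _ : ι => m) := by
  have hp0 : p ≠ 0 := by linarith
  -- Each transfer sets one more coordinate equal to `m`.
  induction hN : (Finset.univ.filter fun j => a j ≠ m).card using Nat.strong_induction_on
    generalizing a with
  | _ N ih =>
  by_cases hall : ∀ j, a j = m
  · rw [show a = fun _ => m from funext hall]
  push Not at hall
  obtain ⟨j₀, hj₀⟩ := hall
  have hne : a j₀ ^ p ≠ m ^ p := fun h => hj₀ ((Real.rpow_left_inj (ha _) hm hp0).1 h)
  obtain ⟨i, hi⟩ : ∃ i, m ^ p < a i ^ p := by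
    by_contra! hcon
    exact hne ((Finset.sum_eq_sum_iff_of_le fun j _ => hcon j).1 hsum j₀ (Finset.mem_univ _))
  obtain ⟨k, hk⟩ : ∃ k, a k ^ p < m ^ p := by
    by_contra! hcon
    exact hne ((Finset.sum_eq_sum_iff_of_le fun j _ => hcon j).1 hsum.symm j₀
      (Finset.mem_univ _)).symm
  have hik : i ≠ k := by
    rintro rfl
    exact lt_asymm hi hk
  have hkp : 0 ≤ a k ^ p := Real.rpow_nonneg (ha k) _
  have hr0 : 0 ≤ a i ^ p + a k ^ p - m ^ p := by linarith
  -- Coordinate `i` drops to `m` and `k` absorbs the excess; since `a k ^ p < m ^ p < a i ^ p`, both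
  -- new `p`-th powers exceed `a k ^ p`, as the transfer requires.
  set r := (a i ^ p + a k ^ p - m ^ p) ^ p⁻¹ with hr
  have hrp : r ^ p = a i ^ p + a k ^ p - m ^ p := Real.rpow_inv_rpow hr0 hp0
  have hrn : 0 ≤ r := Real.rpow_nonneg hr0 _
  set a' : ι → ℝ := Function.update (Function.update a i m) k r with ha'
  have hai : a' i = m := by simp [ha', hik]
  have hak : a' k = r := by simp [ha']
  have hoff : ∀ j, j ≠ i → j ≠ k → a' j = a j := by
    intro j h1 h2
    simp [ha', h1, h2]
  have ha'0 : ∀ j, 0 ≤ a' j := by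
    intro j
    by_cases h2 : j = k
    · rw [h2, hak]; exact hrn
    by_cases h1 : j = i
    · rw [h1, hai]; exact hm
    rw [hoff j h1 h2]; exact ha j
  refine (rademacherPowSum_le_of_transfer hp hik hoff (ha i) (ha k) (ha'0 i) (ha'0 k)
    (by rw [hai, hak, hrp]; ring) (by rw [hai]; exact hk.le) (by rw [hak, hrp]; linarith)).trans ?_
  refine ih _ ?_ a' ha'0 ?_ rfl
  · rw [← hN]
    refine Finset.card_lt_card ⟨fun j hj => ?_, fun hsub => ?_⟩
    · simp only [Finset.mem_filter, Finset.mem_univ, true_and] at hj ⊢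
      by_cases h1 : j = i
      · exact absurd (h1 ▸ hai) hj
      by_cases h2 : j = k
      · rintro h
        rw [← h2, h] at hk
        exact lt_irrefl _ hk
      rwa [← hoff j h1 h2]
    · have : i ∈ Finset.univ.filter fun j => a' j ≠ m := hsub (by
        simp only [Finset.mem_filter, Finset.mem_univ, true_and]
        rintro h
        rw [h] at hi
        exact lt_irrefl _ hi)
      simp [hai] at this
  · rw [← hsum]
    have hs : ∀ b : ι → ℝ, ∑ j, b j ^ p =
        ∑ j ∈ (Finset.univ.erase i).erase k, b j ^ p + (b i ^ p + b k ^ p) := by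
      intro b
      rw [← Finset.sum_erase_add _ _ (Finset.mem_univ i),
        ← Finset.sum_erase_add _ _ (show k ∈ Finset.univ.erase i by simp [hik.symm])]
      ring
    rw [hs a', hs a, hai, hak, hrp]
    congr 1
    · refine Finset.sum_congr rfl fun j hj => ?_
      simp only [Finset.mem_erase, Finset.mem_univ, and_true] at hj
      rw [hoff j hj.2 hj.1]
    · ring

/-- The sharp inequality between Rademacher sums and `ℓᵖ` norms for `p ≥ 2`. -/
theorem rademacherPowSum_le [Nonempty ι] {p : ℝ} (hp : 2 ≤ p) (a : ι → ℝ) :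
    rademacherPowSum p a ≤
      rademacherPowSum p (fun _ : ι => 1) / Fintype.card ι * ∑ j, |a j| ^ p := by
  have hp0 : p ≠ 0 := by linarith
  have hcard : (0 : ℝ) < Fintype.card ι := by exact_mod_cast Fintype.card_pos
  have hS : 0 ≤ (∑ j, |a j| ^ p) / Fintype.card ι :=
    div_nonneg (Finset.sum_nonneg fun j _ => Real.rpow_nonneg (abs_nonneg _) _) hcard.le
  -- The power mean of the entries: the constant vector with the same sum of `p`-th powers.
  -- Homogeneity then extracts `m ^ p`.
  set m := ((∑ j, |a j| ^ p) / Fintype.card ι) ^ p⁻¹ with hm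
  have hmp : m ^ p = (∑ j, |a j| ^ p) / Fintype.card ι := Real.rpow_inv_rpow hS hp0
  have hm0 : 0 ≤ m := Real.rpow_nonneg hS _
  rw [← rademacherPowSum_abs]
  refine (rademacherPowSum_le_const hp hm0 _ (fun j => abs_nonneg _) ?_).trans_eq ?_
  · rw [Finset.sum_const, Finset.card_univ, nsmul_eq_mul, hmp]
    field_simp
  · have : rademacherPowSum p (fun _ : ι => m) = m ^ p * rademacherPowSum p (fun _ : ι => 1) := by
      unfold rademacherPowSum
      rw [Finset.mul_sum]
      refine Finset.sum_congr rfl fun ε _ => ?_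
      rw [← Finset.sum_mul, abs_mul, Real.mul_rpow (abs_nonneg _) (abs_nonneg _), abs_of_nonneg hm0,
        mul_comm]
      simp
    rw [this, hmp]
    field_simp

/-- Orthogonality of the signs: flipping `ε i` negates the mixed products, so only the diagonal
survives. -/
theorem sum_signs_sq (a : ι → ℝ) :
    ∑ ε : ι → ℤˣ, (∑ j, ((ε j : ℤ) : ℝ) * a j) ^ 2 = 2 ^ Fintype.card ι * ∑ j, a j ^ 2 := by
  have horth : ∀ i k : ι, i ≠ k → ∑ ε : ι → ℤˣ, ((ε i : ℤ) : ℝ) * ((ε k : ℤ) : ℝ) = 0 := by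
    intro i k hik
    have := sum_signs_mul (fun ε : ι → ℤˣ => ((ε i : ℤ) : ℝ) * ((ε k : ℤ) : ℝ))
      (Pi.mulSingle i (-1))
    simp only [Pi.mul_apply, Pi.mulSingle_eq_same, Pi.mulSingle_eq_of_ne hik.symm, mul_one,
      mul_neg, Units.val_neg, Int.cast_neg, neg_mul, Finset.sum_neg_distrib] at this
    linarith
  simp only [sq, Finset.sum_mul_sum]
  rw [Finset.sum_comm, Finset.mul_sum]
  refine Finset.sum_congr rfl fun i _ => ?_
  rw [Finset.sum_comm, Finset.sum_eq_single i]
  · have : ∀ ε : ι → ℤˣ, ((ε i : ℤ) : ℝ) * a i * (((ε i : ℤ) : ℝ) * a i) = a i * a i := by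
      intro ε
      rcases Int.units_eq_one_or (ε i) with h | h <;> simp [h]
    simp only [this, Finset.sum_const, Finset.card_univ, Fintype.card_fun, Fintype.card_units_int,
      nsmul_eq_mul]
    push_cast
    ring
  · intro k _ hk
    have : ∀ ε : ι → ℤˣ, ((ε i : ℤ) : ℝ) * a i * (((ε k : ℤ) : ℝ) * a k) =
        ((ε i : ℤ) : ℝ) * ((ε k : ℤ) : ℝ) * (a i * a k) := fun ε => by ring
    simp only [this]
    rw [← Finset.sum_mul, horth i k hk.symm, zero_mul]
  · simp

end SignSums

/-! ### The quotient as a sum over all signs -/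

/-- Negating all the signs exchanges the halves `ε 0 = 1` and `ε 0 = -1`, and `G` is even. -/
theorem sum_signs_eq_two_mul {n : ℕ} [NeZero n] {X : Type*} [AddCommGroup X] (G : X → ℝ)
    (hG : ∀ x, G (-x) = G x) (x : Fin n → X) :
    ∑ ε : Fin n → ℤˣ, G (∑ j, (ε j : ℤ) • x j) =
      2 * ∑ θ : {j : Fin n // j ≠ 0} → ℤˣ,
        G (x 0 + ∑ j : {j : Fin n // j ≠ 0}, ((θ j : ℤˣ) : ℤ) • x j) := by
  have hsum : ∀ ε : Fin n → ℤˣ, ∑ j, (ε j : ℤ) • x j =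
      (ε 0 : ℤ) • x 0 + ∑ j : {j : Fin n // j ≠ 0}, (ε j : ℤ) • x j := by
    intro ε
    exact Fintype.sum_eq_add_sum_subtype_ne _ 0
  rw [Fintype.sum_equiv (Equiv.funSplitAt (0 : Fin n) ℤˣ) _
    (fun q => G ((q.1 : ℤ) • x 0 + ∑ j : {j : Fin n // j ≠ 0}, (q.2 j : ℤ) • x j))
    (fun ε => by rw [hsum]; rfl), Fintype.sum_prod_type]
  have hu : ∀ f : ℤˣ → ℝ, ∑ u, f u = f 1 + f (-1) := by
    intro f
    rw [show (Finset.univ : Finset ℤˣ) = {1, -1} by decide, Finset.sum_pair (by decide)]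
  rw [hu, two_mul]
  congr 1
  · simp
  · refine Fintype.sum_equiv (Equiv.neg _) _ _ fun θ => ?_
    rw [← hG]
    congr 1
    simp [add_comm]

theorem njQuotient_eq_sum_signs {n : ℕ} [NeZero n] {X : Type*} [NormedAddCommGroup X]
    (x : Fin n → X) :
    njQuotient n x = (∑ ε : Fin n → ℤˣ, ‖∑ j, (ε j : ℤ) • x j‖ ^ 2) / (2 ^ n * ∑ j, ‖x j‖ ^ 2) := by
  unfold njQuotient
  rw [sum_signs_eq_two_mul (fun y : X => ‖y‖ ^ 2) (fun y => by rw [norm_neg])]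
  have : (2 : ℝ) ^ n = 2 * 2 ^ (n - 1) := by
    rw [← pow_succ', Nat.sub_add_cancel (Nat.pos_of_ne_zero (NeZero.ne n))]
  rw [this, mul_assoc, mul_div_mul_left _ _ two_ne_zero]

/-! ### Upper bounds in `Lᵖ` -/

theorem rpow_sum_le_sum_rpow_of_nonneg {ι : Type*} (s : Finset ι) (f : ι → ℝ) {q : ℝ} (hq : 0 < q)
    (hq1 : q ≤ 1) (hf : ∀ i ∈ s, 0 ≤ f i) : (∑ i ∈ s, f i) ^ q ≤ ∑ i ∈ s, f i ^ q :=
  Finset.le_sum_of_subadditive_on_pred (fun x : ℝ => x ^ q) (fun x => 0 ≤ x)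
    (by simp [Real.zero_rpow hq.ne'])
    (fun _ _ hx hy => Real.rpow_add_le_add_rpow hx hy hq.le hq1)
    (fun _ _ hx hy => add_nonneg hx hy) f hf

/-- Hölder's inequality with exponents `2 / (2 - p)` and `2 / p`. -/
theorem sum_rpow_mul_abs_rpow_le {ι : Type*} (s : Finset ι) (N y : ι → ℝ) {p : ℝ} (hp : 1 ≤ p)
    (hp2 : p ≤ 2) (hN : ∀ i ∈ s, 0 ≤ N i) :
    ∑ i ∈ s, N i ^ (2 - p) * |y i| ^ p ≤
      (∑ i ∈ s, N i ^ 2) ^ ((2 - p) / 2) * (∑ i ∈ s, y i ^ 2) ^ (p / 2) := by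
  -- At `p = 2` the exponent `2 / (2 - p)` degenerates, but the claim is then an equality.
  rcases hp2.eq_or_lt with rfl | hlt
  · simp
  have hp0 : 0 < p := by linarith
  have h2p : 0 < 2 - p := by linarith
  have hc : Real.HolderConjugate (2 / (2 - p)) (2 / p) := by
    rw [Real.holderConjugate_iff]
    constructor
    · rw [lt_div_iff₀ h2p]
      linarith
    · rw [inv_div, inv_div]
      ring
  have := Real.inner_le_Lp_mul_Lq_of_nonneg s (f := fun i => N i ^ (2 - p))
    (g := fun i => |y i| ^ p) hc (fun i hi => Real.rpow_nonneg (hN i hi) _)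
    (fun i _ => Real.rpow_nonneg (abs_nonneg _) _)
  refine this.trans_eq ?_
  rw [one_div_div, one_div_div]
  congr 2
  · refine Finset.sum_congr rfl fun i hi => ?_
    rw [← Real.rpow_mul (hN i hi), mul_div_cancel₀ _ h2p.ne', Real.rpow_two]
  · refine Finset.sum_congr rfl fun i hi => ?_
    rw [← Real.rpow_mul (abs_nonneg _), mul_div_cancel₀ _ hp0.ne', Real.rpow_two, sq_abs]

section LpUpper

variable {Ω : Type*} [MeasurableSpace Ω] {μ : Measure Ω} {p : ℝ≥0∞}

theorem Lp_integrable_abs_rpow (hp0 : p ≠ 0) (hp : p ≠ ∞) (f : Lp ℝ p μ) :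
    Integrable (fun t => |f t| ^ p.toReal) μ := by
  simpa using (Lp.memLp f).integrable_norm_rpow hp0 hp

theorem Lp_norm_rpow_eq_integral (hp0 : p ≠ 0) (hp : p ≠ ∞) (f : Lp ℝ p μ) :
    ‖f‖ ^ p.toReal = ∫ t, |f t| ^ p.toReal ∂μ := by
  have hr : p.toReal ≠ 0 := ENNReal.toReal_ne_zero.2 ⟨hp0, hp⟩
  rw [Lp.norm_def, toReal_eLpNorm (Lp.aestronglyMeasurable f),
    lpNorm_eq_integral_norm_rpow_toReal hp0 hp (Lp.aestronglyMeasurable f), Real.rpow_inv_rpow _ hr]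
  · simp
  · exact integral_nonneg fun t => Real.rpow_nonneg (norm_nonneg _) _

theorem Lp_coeFn_sum_smul {ι : Type*} (s : Finset ι) (c : ι → ℝ) (f : ι → Lp ℝ p μ) :
    (∑ i ∈ s, c i • f i : Lp ℝ p μ) =ᵐ[μ] fun t => ∑ i ∈ s, c i * f i t := by
  have h : ∀ᵐ t ∂μ, ∀ i ∈ s, (c i • f i : Lp ℝ p μ) t = c i * f i t := by
    rw [Filter.eventually_all_finset]
    intro i _
    filter_upwards [Lp.coeFn_smul (c i) (f i)] with t ht
    simpa using ht
  filter_upwards [Lp.coeFn_finsetSum s fun i => c i • f i, h] with t h1 h2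
  rw [h1, Finset.sum_apply]
  exact Finset.sum_congr rfl h2

theorem Lp_coeFn_signed_sum {ι : Type*} [Fintype ι] (ε : ι → ℤˣ) (f : ι → Lp ℝ p μ) :
    (∑ i, (ε i : ℤ) • f i : Lp ℝ p μ) =ᵐ[μ] fun t => ∑ i, ((ε i : ℤ) : ℝ) * f i t := by
  have := Lp_coeFn_sum_smul Finset.univ (fun i => ((ε i : ℤ) : ℝ)) f
  simpa only [Int.cast_smul_eq_zsmul] using this

variable {ι : Type*} [Fintype ι]

theorem Lp_norm_signed_sum_rpow (hp0 : p ≠ 0) (hp : p ≠ ∞) (ε : ι → ℤˣ) (f : ι → Lp ℝ p μ) :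
    ‖∑ i, (ε i : ℤ) • f i‖ ^ p.toReal = ∫ t, |∑ i, ((ε i : ℤ) : ℝ) * f i t| ^ p.toReal ∂μ := by
  rw [Lp_norm_rpow_eq_integral hp0 hp]
  refine integral_congr_ae ?_
  filter_upwards [Lp_coeFn_signed_sum ε f] with t ht
  rw [ht]

theorem Lp_integrable_signed_sum_rpow (hp0 : p ≠ 0) (hp : p ≠ ∞) (ε : ι → ℤˣ) (f : ι → Lp ℝ p μ) :
    Integrable (fun t => |∑ i, ((ε i : ℤ) : ℝ) * f i t| ^ p.toReal) μ := by
  refine (Lp_integrable_abs_rpow hp0 hp (∑ i, (ε i : ℤ) • f i)).congr ?_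
  filter_upwards [Lp_coeFn_signed_sum ε f] with t ht
  rw [ht]

variable [DecidableEq ι]

/-- The Clarkson type inequality in `Lᵖ` for `p ≥ 2`, with the sharp constant. -/
theorem Lp_sum_signs_norm_rpow_le [Nonempty ι] (hp2 : 2 ≤ p) (hp : p ≠ ∞) (f : ι → Lp ℝ p μ) :
    ∑ ε : ι → ℤˣ, ‖∑ i, (ε i : ℤ) • f i‖ ^ p.toReal ≤
      rademacherPowSum p.toReal (fun _ : ι => 1) / Fintype.card ι * ∑ i, ‖f i‖ ^ p.toReal := by
  have hp0 : p ≠ 0 := (lt_of_lt_of_le (by norm_num) hp2).ne'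
  have hr : 2 ≤ p.toReal := by simpa using ENNReal.toReal_mono hp hp2
  simp only [Lp_norm_signed_sum_rpow hp0 hp, fun i => Lp_norm_rpow_eq_integral hp0 hp (f i)]
  rw [← integral_finsetSum _ fun ε _ => Lp_integrable_signed_sum_rpow hp0 hp ε f,
    ← integral_finsetSum _ fun i _ => Lp_integrable_abs_rpow hp0 hp (f i), ← integral_const_mul]
  refine integral_mono (integrable_finsetSum _ fun ε _ => Lp_integrable_signed_sum_rpow hp0 hp ε f)
    ((integrable_finsetSum _ fun i _ => Lp_integrable_abs_rpow hp0 hp (f i)).const_mul _)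
    fun t => ?_
  exact rademacherPowSum_le hr fun i => f i t

/-- `Lᵖ` has type `p` for `1 ≤ p ≤ 2` with constant one, for second moments of signed sums. -/
theorem Lp_sum_signs_norm_sq_le [Fact (1 ≤ p)] (hp2 : p ≤ 2) (f : ι → Lp ℝ p μ) :
    ∑ ε : ι → ℤˣ, ‖∑ i, (ε i : ℤ) • f i‖ ^ 2 ≤
      2 ^ Fintype.card ι * (∑ i, ‖f i‖ ^ p.toReal) ^ (2 / p.toReal) := by
  have hp1 : 1 ≤ p := Fact.out
  have hp0 : p ≠ 0 := (lt_of_lt_of_le (by norm_num) hp1).ne'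
  have hp : p ≠ ∞ := (lt_of_le_of_lt hp2 (by norm_num)).ne
  have hr1 : 1 ≤ p.toReal := by simpa using ENNReal.toReal_mono hp hp1
  have hr2 : p.toReal ≤ 2 := by simpa using ENNReal.toReal_mono (by norm_num) hp2
  set r := p.toReal with hrdef
  have hr0 : 0 < r := by linarith
  set N : (ι → ℤˣ) → ℝ := fun ε => ‖∑ i, (ε i : ℤ) • f i‖ with hN
  have hN0 : ∀ ε, 0 ≤ N ε := fun ε => norm_nonneg _
  set D := ∑ ε, N ε ^ 2 with hD
  have hD0 : 0 ≤ D := Finset.sum_nonneg fun ε _ => sq_nonneg _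
  set B := ∑ i, ‖f i‖ ^ r with hB
  have hB0 : 0 ≤ B := Finset.sum_nonneg fun i _ => Real.rpow_nonneg (norm_nonneg _) _
  -- The weights `N ε ^ (2 - r)` are chosen so that integrating the left side returns `∑ N ε ^ 2 =
  -- D`, while Hölder bounds it pointwise by a power of `D` smaller than one.
  have hpt : ∀ t, ∑ ε : ι → ℤˣ, N ε ^ (2 - r) * |∑ i, ((ε i : ℤ) : ℝ) * f i t| ^ r ≤
      D ^ ((2 - r) / 2) * (2 ^ Fintype.card ι : ℝ) ^ (r / 2) * ∑ i, |f i t| ^ r := by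
    intro t
    refine (sum_rpow_mul_abs_rpow_le _ N _ hr1 hr2 fun ε _ => hN0 ε).trans ?_
    rw [sum_signs_sq, Real.mul_rpow (by positivity) (Finset.sum_nonneg fun i _ => sq_nonneg _),
      ← mul_assoc]
    refine mul_le_mul_of_nonneg_left ?_ (mul_nonneg (Real.rpow_nonneg hD0 _) (by positivity))
    refine (rpow_sum_le_sum_rpow_of_nonneg _ _ (by positivity) (by linarith)
      fun i _ => sq_nonneg _).trans_eq (Finset.sum_congr rfl fun i _ => ?_)
    rw [← sq_abs, ← Real.rpow_two, ← Real.rpow_mul (abs_nonneg _), mul_div_cancel₀ _ two_ne_zero]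
  have hint : D ≤ D ^ ((2 - r) / 2) * (2 ^ Fintype.card ι : ℝ) ^ (r / 2) * B := by
    have e1 : D = ∫ t, ∑ ε : ι → ℤˣ, N ε ^ (2 - r) * |∑ i, ((ε i : ℤ) : ℝ) * f i t| ^ r ∂μ := by
      rw [integral_finsetSum _ fun ε _ =>
        (Lp_integrable_signed_sum_rpow hp0 hp ε f).const_mul _]
      refine Finset.sum_congr rfl fun ε _ => ?_
      rw [integral_const_mul, ← Lp_norm_signed_sum_rpow hp0 hp, ← hrdef,
        ← Real.rpow_add_of_nonneg (hN0 ε) (by linarith) hr0.le, sub_add_cancel, Real.rpow_two]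
    have e2 : B = ∫ t, ∑ i, |f i t| ^ r ∂μ := by
      rw [integral_finsetSum _ fun i _ => Lp_integrable_abs_rpow hp0 hp (f i)]
      exact Finset.sum_congr rfl fun i _ => Lp_norm_rpow_eq_integral hp0 hp (f i)
    rw [e2, ← integral_const_mul]
    conv_lhs => rw [e1]
    exact integral_mono (integrable_finsetSum _ fun ε _ =>
        (Lp_integrable_signed_sum_rpow hp0 hp ε f).const_mul _)
      ((integrable_finsetSum _ fun i _ => Lp_integrable_abs_rpow hp0 hp (f i)).const_mul _) hpt
  -- Positivity of `D` is needed to cancel `D ^ ((2 - r) / 2)` from `hint`.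
  rcases hD0.eq_or_lt with h0 | hpos
  · rw [← h0]
    positivity
  have h3 : D ^ (r / 2) ≤ (2 ^ Fintype.card ι : ℝ) ^ (r / 2) * B := by
    refine le_of_mul_le_mul_left ?_ (Real.rpow_pos_of_pos hpos ((2 - r) / 2))
    rw [← Real.rpow_add hpos, ← mul_assoc, show (2 - r) / 2 + r / 2 = 1 by ring, Real.rpow_one]
    exact hint
  have h4 := Real.rpow_le_rpow (Real.rpow_nonneg hD0 _) h3 (show 0 ≤ 2 / r by positivity)
  rwa [Real.mul_rpow (by positivity) hB0, ← Real.rpow_mul hD0, ← Real.rpow_mul (by positivity),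
    show r / 2 * (2 / r) = 1 by field_simp, Real.rpow_one, Real.rpow_one] at h4

end LpUpper

theorem njQuotient_map {n : ℕ} [NeZero n] {X Y : Type*} [NormedAddCommGroup X] [NormedSpace ℝ X]
    [NormedAddCommGroup Y] [NormedSpace ℝ Y] (T : X →ₗᵢ[ℝ] Y) (x : Fin n → X) :
    njQuotient n (fun j => T (x j)) = njQuotient n x := by
  unfold njQuotient
  simp only [T.norm_map]
  congr 1
  refine Finset.sum_congr rfl fun θ _ => ?_
  rw [← T.norm_map (x 0 + _)]
  simp only [map_add, map_sum, map_zsmul]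

theorem njQuotient_eq_of_norm_eq_one {n : ℕ} [NeZero n] {X : Type*} [NormedAddCommGroup X]
    {x : Fin n → X} (hx : ∀ j, ‖x j‖ = 1) :
    njQuotient n x = (∑ ε : Fin n → ℤˣ, ‖∑ j, (ε j : ℤ) • x j‖ ^ 2) / (2 ^ n * n) := by
  rw [njQuotient_eq_sum_signs]
  simp [hx]

section NJUpper

variable {Ω : Type*} [MeasurableSpace Ω] {μ : Measure Ω} {p : ℝ≥0∞} [Fact (1 ≤ p)]

theorem Lp_njQuotient_le_of_le_two (hp2 : p ≤ 2) {n : ℕ} [NeZero n]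
    (x : Fin n → Lp ℝ p μ) (hx : ∀ j, ‖x j‖ = 1) :
    njQuotient n x ≤ (n : ℝ) ^ (2 / p.toReal - 1) := by
  have hn : (0 : ℝ) < n := by exact_mod_cast Nat.pos_of_ne_zero (NeZero.ne n)
  have h := Lp_sum_signs_norm_sq_le hp2 x
  simp only [hx, Real.one_rpow, Finset.sum_const, Finset.card_univ, Fintype.card_fin, nsmul_eq_mul,
    mul_one] at h
  rw [njQuotient_eq_of_norm_eq_one hx, div_le_iff₀ (by positivity)]
  refine h.trans_eq ?_
  rw [Real.rpow_sub_one hn.ne']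
  field_simp

theorem Lp_njQuotient_le_of_two_le (hp2 : 2 ≤ p) (hp : p ≠ ∞) {n : ℕ} [NeZero n]
    (x : Fin n → Lp ℝ p μ) (hx : ∀ j, ‖x j‖ = 1) :
    njQuotient n x ≤ (n : ℝ)⁻¹ *
      (rademacherPowSum p.toReal (fun _ : Fin n => 1) / 2 ^ n) ^ (2 / p.toReal) := by
  have hn : (0 : ℝ) < n := by exact_mod_cast Nat.pos_of_ne_zero (NeZero.ne n)
  have : Nonempty (Fin n) := ⟨0⟩
  have hr : 2 ≤ p.toReal := by simpa using ENNReal.toReal_mono hp hp2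
  have hr0 : 0 < p.toReal := by linarith
  have h := Lp_sum_signs_norm_rpow_le hp2 hp x
  simp only [hx, Real.one_rpow, Finset.sum_const, Finset.card_univ, Fintype.card_fin, nsmul_eq_mul,
    mul_one] at h
  rw [div_mul_cancel₀ _ hn.ne'] at h
  have hcard : ∑ _ε : Fin n → ℤˣ, ((2 : ℝ) ^ n)⁻¹ = 1 := by
    rw [Finset.sum_const, Finset.card_univ, Fintype.card_fun, Fintype.card_units_int,
      Fintype.card_fin, nsmul_eq_mul]
    push_cast
    field_simp
  -- Jensen for `x ^ (p / 2)` under the uniform measure on signs, passing from second to `p`-th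
  -- moments. It loses nothing when all signed sums have equal norm.
  have hpm := Real.rpow_arith_mean_le_arith_mean_rpow Finset.univ
    (fun _ : Fin n → ℤˣ => ((2 : ℝ) ^ n)⁻¹) (fun ε => ‖∑ j, (ε j : ℤ) • x j‖ ^ 2)
    (fun _ _ => by positivity) hcard (fun _ _ => by positivity)
    (show 1 ≤ p.toReal / 2 by linarith)
  have e : ∀ ε : Fin n → ℤˣ, (‖∑ j, (ε j : ℤ) • x j‖ ^ 2) ^ (p.toReal / 2) =
      ‖∑ j, (ε j : ℤ) • x j‖ ^ p.toReal := by
    intro ε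
    rw [← Real.rpow_two, ← Real.rpow_mul (norm_nonneg _), mul_div_cancel₀ _ two_ne_zero]
  simp only [e] at hpm
  rw [← Finset.mul_sum, ← Finset.mul_sum] at hpm
  have hS : 0 ≤ ((2 : ℝ) ^ n)⁻¹ * ∑ ε : Fin n → ℤˣ, ‖∑ j, (ε j : ℤ) • x j‖ ^ 2 := by positivity
  have h2 := hpm.trans (mul_le_mul_of_nonneg_left h (by positivity))
  have h3 := Real.rpow_le_rpow (Real.rpow_nonneg hS _) h2 (show 0 ≤ 2 / p.toReal by positivity)
  rw [← Real.rpow_mul hS, show p.toReal / 2 * (2 / p.toReal) = 1 by field_simp, Real.rpow_one,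
    inv_mul_eq_div _ (rademacherPowSum _ _)] at h3
  rw [njQuotient_eq_of_norm_eq_one hx]
  refine Eq.trans_le ?_ (mul_le_mul_of_nonneg_left h3 (inv_nonneg.2 hn.le))
  field_simp

end NJUpper

/-! ### Extremal vectors in a copy of `ℓ^r` -/

theorem upperModifiedNJ_eq {n : ℕ} [NeZero n] {X : Type*} [NormedAddCommGroup X] {v : ℝ}
    (hv : 0 < v) (hub : ∀ x : Fin n → X, (∀ j, ‖x j‖ = 1) → njQuotient n x ≤ v)
    {x : Fin n → X} (hx : ∀ j, ‖x j‖ = 1) (hxv : njQuotient n x = v) :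
    upperModifiedNJ n X = v := by
  have h : IsLeast (modifiedNJBounds n X) v :=
    ⟨⟨hv, fun y hy => hub y fun j => by simpa using hy j⟩,
      fun C hC => hxv ▸ hC.2 x fun j => by simpa using hx j⟩
  exact h.csInf_eq

/-- A family that spans an isometric copy of the finite-dimensional `ℓ^r`. -/
def IsIsometricBasis {X : Type*} [NormedAddCommGroup X] [NormedSpace ℝ X] (r : ℝ) {κ : Type*}
    [Fintype κ] (e : κ → X) : Prop :=
  ∀ c : κ → ℝ, ‖∑ i, c i • e i‖ ^ r = ∑ i, |c i| ^ r

theorem norm_eq_one_of_rpow {X : Type*} [NormedAddCommGroup X] {r : ℝ} (hr : 0 < r) {x : X}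
    (h : ‖x‖ ^ r = 1) : ‖x‖ = 1 :=
  (Real.rpow_left_inj (norm_nonneg _) zero_le_one hr.ne').1 (h.trans (Real.one_rpow r).symm)

theorem rpow_eq_imp_sq_eq {x y r : ℝ} (hr : 0 < r) (hx : 0 ≤ x) (h : x ^ r = y) :
    x ^ 2 = y ^ (2 / r) := by
  rw [← h, ← Real.rpow_mul hx, mul_div_cancel₀ _ hr.ne', Real.rpow_two]

/-- If all signed sums of unit vectors have the same norm, the quotient is that norm squared over
`n`. -/
theorem njQuotient_eq_of_forall_norm_rpow_eq {n : ℕ} [NeZero n] {X : Type*}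
    [NormedAddCommGroup X] {r : ℝ} (hr : 0 < r) {x : Fin n → X} (hx : ∀ j, ‖x j‖ = 1) {K : ℝ}
    (hK : ∀ ε : Fin n → ℤˣ, ‖∑ j, (ε j : ℤ) • x j‖ ^ r = K) :
    njQuotient n x = (n : ℝ)⁻¹ * K ^ (2 / r) := by
  rw [njQuotient_eq_of_norm_eq_one hx]
  simp only [fun ε => rpow_eq_imp_sq_eq hr (norm_nonneg _) (hK ε), Finset.sum_const,
    Finset.card_univ, Fintype.card_fun, Fintype.card_units_int, Fintype.card_fin, nsmul_eq_mul]
  push_cast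
  field_simp

section Lower

variable {X : Type*} [NormedAddCommGroup X] [NormedSpace ℝ X] {r : ℝ} {κ : Type*} [Fintype κ]
  {e : κ → X}

theorem IsIsometricBasis.comp_equiv {κ' : Type*} [Fintype κ'] (he : IsIsometricBasis r e)
    (σ : κ' ≃ κ) : IsIsometricBasis r (e ∘ σ) := by
  intro c
  have := he (c ∘ σ.symm)
  rw [← Equiv.sum_comp σ, ← Equiv.sum_comp σ] at this
  simpa using this

theorem IsIsometricBasis.norm_signed_sum (he : IsIsometricBasis r e) {n : ℕ}
    (A : Fin n → κ → ℝ) (ε : Fin n → ℤˣ) :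
    ‖∑ j, (ε j : ℤ) • ∑ i, A j i • e i‖ ^ r = ∑ i, |∑ j, ((ε j : ℤ) : ℝ) * A j i| ^ r := by
  rw [← he]
  congr 2
  simp only [Finset.sum_smul, Finset.smul_sum]
  rw [Finset.sum_comm]
  refine Finset.sum_congr rfl fun i _ => Finset.sum_congr rfl fun j _ => ?_
  rw [← Int.cast_smul_eq_zsmul ℝ, smul_smul]

/-- The basis vectors themselves serve: every signed sum has norm `n ^ (1 / r)`. -/
theorem exists_njQuotient_eq_of_le_two (hr : 0 < r) {n : ℕ} [NeZero n] {e : Fin n → X}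
    (he : IsIsometricBasis r e) :
    ∃ x : Fin n → X, (∀ j, ‖x j‖ = 1) ∧ njQuotient n x = (n : ℝ) ^ (2 / r - 1) := by
  have hn : (0 : ℝ) < n := by exact_mod_cast Nat.pos_of_ne_zero (NeZero.ne n)
  have h1 : ∀ j, ‖e j‖ = 1 := by
    intro j
    apply norm_eq_one_of_rpow hr
    have := he (Pi.single j 1)
    simpa [Pi.single_apply, apply_ite (fun x : ℝ => |x|), ite_pow, Finset.sum_ite_eq,
      apply_ite (fun x : ℝ => x ^ r), Real.zero_rpow hr.ne'] using this
  refine ⟨e, h1, ?_⟩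
  rw [njQuotient_eq_of_forall_norm_rpow_eq (K := n) hr h1]
  · rw [Real.rpow_sub_one hn.ne']
    field_simp
  · intro ε
    have := he fun j => ((ε j : ℤ) : ℝ)
    simp only [Int.cast_smul_eq_zsmul] at this
    rw [this]
    have ha : ∀ j, |((ε j : ℤ) : ℝ)| = 1 := by
      intro j
      rcases Int.units_eq_one_or (ε j) with h | h <;> simp [h]
    simp [ha]

/-- The vectors are normalized Rademacher functions on the sign patterns `θ`, the first one
constant. The coordinates of any signed sum run, up to a global sign, through all values `∑ ± 1`.
That freedom of sign is why `2 ^ (n - 1)` coordinates suffice. -/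
theorem exists_njQuotient_eq_of_two_lt (hr : 0 < r) {n : ℕ} [NeZero n]
    {e : ({j : Fin n // j ≠ 0} → ℤˣ) → X} (he : IsIsometricBasis r e) :
    ∃ x : Fin n → X, (∀ j, ‖x j‖ = 1) ∧ njQuotient n x =
      (n : ℝ)⁻¹ * (rademacherPowSum r (fun _ : Fin n => 1) / 2 ^ n) ^ (2 / r) := by
  have hn : (2 : ℝ) ^ n = 2 * 2 ^ (n - 1) := by
    rw [← pow_succ', Nat.sub_add_cancel (Nat.pos_of_ne_zero (NeZero.ne n))]
  set w : ℝ := ((2 : ℝ) ^ (n - 1))⁻¹ ^ r⁻¹ with hw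
  have hw0 : 0 ≤ w := by positivity
  have hwr : w ^ r = ((2 : ℝ) ^ (n - 1))⁻¹ := Real.rpow_inv_rpow (by positivity) hr.ne'
  let s : Fin n → ({j : Fin n // j ≠ 0} → ℤˣ) → ℤˣ := fun j θ =>
    if h : j ≠ 0 then θ ⟨j, h⟩ else 1
  have habs : ∀ u : ℤˣ, |((u : ℤ) : ℝ)| = 1 := by
    intro u
    rcases Int.units_eq_one_or u with h | h <;> simp [h]
  have hx : ∀ j, ‖∑ θ, (w * ((s j θ : ℤ) : ℝ)) • e θ‖ = 1 := by
    intro j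
    apply norm_eq_one_of_rpow hr
    rw [he]
    simp only [abs_mul, habs, mul_one, abs_of_nonneg hw0, hwr, Finset.sum_const, Finset.card_univ,
      Fintype.card_fun, Fintype.card_units_int, nsmul_eq_mul]
    have hc : Fintype.card {j : Fin n // j ≠ 0} = n - 1 := by
      simp [Fintype.card_subtype_compl]
    rw [hc]
    push_cast
    field_simp
  refine ⟨_, hx, njQuotient_eq_of_forall_norm_rpow_eq hr hx fun ε => ?_⟩
  rw [he.norm_signed_sum (fun j θ => w * ((s j θ : ℤ) : ℝ))]
  have h1 : ∀ θ, |∑ j, ((ε j : ℤ) : ℝ) * (w * ((s j θ : ℤ) : ℝ))| ^ r =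
      w ^ r * |((ε 0 : ℤ) : ℝ) + ∑ j : {j : Fin n // j ≠ 0}, (θ j : ℤ) • ((ε j : ℤ) : ℝ)| ^ r := by
    intro θ
    rw [← abs_of_nonneg hw0, ← Real.mul_rpow (abs_nonneg _) (abs_nonneg _), ← abs_mul,
      abs_of_nonneg hw0, Fintype.sum_eq_add_sum_subtype_ne _ 0, mul_add, Finset.mul_sum]
    congr 3
    · simp [s, mul_comm]
    · refine Finset.sum_congr rfl fun j _ => ?_
      simp only [s, dif_pos j.2, zsmul_eq_mul]
      ring
  simp only [h1]
  rw [← Finset.mul_sum, hwr]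
  have h2 := sum_signs_eq_two_mul (fun z : ℝ => |z| ^ r) (fun z => by rw [abs_neg])
    (fun j => ((ε j : ℤ) : ℝ))
  -- Entries of modulus one can be replaced by ones, so the norm does not depend on `ε`.
  have h3 : rademacherPowSum r (fun _ : Fin n => (1 : ℝ)) =
      ∑ δ : Fin n → ℤˣ, |∑ j, (δ j : ℤ) • ((ε j : ℤ) : ℝ)| ^ r := by
    have := rademacherPowSum_abs r fun j => ((ε j : ℤ) : ℝ)
    simp only [habs] at this
    rw [this]
    simp only [rademacherPowSum, zsmul_eq_mul]
  rw [h3, h2, hn, mul_div_mul_left _ _ two_ne_zero, inv_mul_eq_div]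

end Lower

/-! ### The binomial form of the constant -/

/-- Folding along `k ↦ n - k`. For even `n` the fixed point `k = n / 2` would be counted twice on
the right, which is harmless because its term vanishes. -/
theorem sum_range_symm_eq_two_mul (n : ℕ) (g : ℕ → ℝ) (hsymm : ∀ k ≤ n, g (n - k) = g k)
    (hmid : ∀ k, 2 * k = n → g k = 0) :
    ∑ k ∈ Finset.range (n + 1), g k = 2 * ∑ k ∈ Finset.range (n / 2 + 1), g k := by
  have h1 : ∑ k ∈ Finset.range (n / 2 + 1), g k =
      ∑ k ∈ (Finset.range (n + 1)).filter (fun k => 2 * k ≤ n), g k := by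
    congr 1
    ext k
    simp only [Finset.mem_range, Finset.mem_filter]
    omega
  have h2 : ∑ k ∈ (Finset.range (n + 1)).filter (fun k => ¬ 2 * k ≤ n), g k =
      ∑ k ∈ (Finset.range (n + 1)).filter (fun k => 2 * k < n), g k := by
    refine Finset.sum_nbij' (fun k => n - k) (fun k => n - k) ?_ ?_ ?_ ?_ ?_
    · intro k hk
      simp only [Finset.mem_range, Finset.mem_filter] at hk ⊢
      omega
    · intro k hk
      simp only [Finset.mem_range, Finset.mem_filter] at hk ⊢
      omega
    · intro k hk
      simp only [Finset.mem_range, Finset.mem_filter] at hk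
      omega
    · intro k hk
      simp only [Finset.mem_range, Finset.mem_filter] at hk
      omega
    · intro k hk
      simp only [Finset.mem_range, Finset.mem_filter] at hk
      rw [hsymm k (by omega)]
  have h3 : ∑ k ∈ (Finset.range (n + 1)).filter (fun k => 2 * k < n), g k =
      ∑ k ∈ (Finset.range (n + 1)).filter (fun k => 2 * k ≤ n), g k := by
    refine Finset.sum_subset (fun k hk => ?_) fun k hk hk' => ?_
    · simp only [Finset.mem_range, Finset.mem_filter] at hk ⊢
      omega
    · simp only [Finset.mem_range, Finset.mem_filter] at hk hk'
      exact hmid k (by omega)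
  rw [← Finset.sum_filter_add_sum_filter_not _ (fun k => 2 * k ≤ n), h2, h3, h1]
  ring

/-- Grouping sign vectors by the number `k` of minus signs, where the sum of signs is `n - 2 * k`.
-/
theorem rademacherPowSum_one_eq_sum_choose (n : ℕ) (r : ℝ) :
    rademacherPowSum r (fun _ : Fin n => 1) =
      ∑ k ∈ Finset.range (n + 1), (n.choose k : ℝ) * |(n : ℝ) - 2 * k| ^ r := by
  have h1 := Finset.sum_powerset_apply_card (x := (Finset.univ : Finset (Fin n)))
    (fun k : ℕ => |(n : ℝ) - 2 * k| ^ r)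
  rw [Finset.card_univ, Fintype.card_fin, Finset.powerset_univ] at h1
  simp only [nsmul_eq_mul] at h1
  rw [← h1]
  unfold rademacherPowSum
  refine Finset.sum_bij' (fun ε _ => Finset.univ.filter fun j => ε j = -1)
    (fun s _ => fun j => if j ∈ s then -1 else 1) (by simp) (by simp) ?_ ?_ ?_
  · intro ε _
    funext j
    rcases Int.units_eq_one_or (ε j) with h | h <;> simp [h]
  · intro s _
    ext j
    by_cases h : j ∈ s <;> simp [h]
  · intro ε _
    have h2 : ∀ j, ((ε j : ℤ) : ℝ) * 1 = 1 - 2 * (if ε j = -1 then 1 else 0) := by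
      intro j
      rcases Int.units_eq_one_or (ε j) with h | h
      · simp [h]
      · simp [h]
        norm_num
    simp only [h2, Finset.sum_sub_distrib, ← Finset.mul_sum, Finset.sum_boole]
    simp

theorem rademacherPowSum_one_div {n : ℕ} {r : ℝ} (hr : 0 < r) :
    rademacherPowSum r (fun _ : Fin n => 1) / 2 ^ n =
      (2 : ℝ) ^ (1 - (n : ℝ)) * ∑ k ∈ Finset.range (n / 2 + 1),
            (n.choose k : ℝ) * ((n : ℝ) - 2 * k) ^ r := by
  rw [rademacherPowSum_one_eq_sum_choose, sum_range_symm_eq_two_mul]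
  · rw [Real.rpow_sub two_pos, Real.rpow_one, Real.rpow_natCast]
    have : ∑ k ∈ Finset.range (n / 2 + 1), (n.choose k : ℝ) * |(n : ℝ) - 2 * k| ^ r =
        ∑ k ∈ Finset.range (n / 2 + 1), (n.choose k : ℝ) * ((n : ℝ) - 2 * k) ^ r := by
      refine Finset.sum_congr rfl fun k hk => ?_
      rw [Finset.mem_range] at hk
      have : ((2 * k : ℕ) : ℝ) ≤ n := by
        exact_mod_cast (by omega : 2 * k ≤ n)
      push_cast at this
      rw [abs_of_nonneg (by linarith)]
    rw [this]
    ring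
  · intro k hk
    rw [Nat.choose_symm hk, Nat.cast_sub hk, ← abs_neg]
    congr 3
    ring
  · rintro k rfl
    simp [Real.zero_rpow hr.ne']

theorem rademacherPowSum_one_pos (n : ℕ) [NeZero n] (r : ℝ) :
    0 < rademacherPowSum r (fun _ : Fin n => 1) := by
  refine Finset.sum_pos' (fun ε _ => Real.rpow_nonneg (abs_nonneg _) _)
    ⟨fun _ => 1, Finset.mem_univ _, ?_⟩
  apply Real.rpow_pos_of_pos
  simpa using Nat.pos_of_ne_zero (NeZero.ne n)

/-! ### Copies of `ℓᵖ` in `Lᵖ(μ)` from disjoint sets -/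

section DisjointSets

variable {Ω : Type*} [MeasurableSpace Ω] {μ : Measure Ω} {p : ℝ≥0∞} [Fact (1 ≤ p)]

/-- A disjoint family of measurable sets with positive finite measure. -/
structure IsDisjointPosFamily (μ : Measure Ω) {k : ℕ} (A : Fin k → Set Ω) : Prop where
  measurableSet : ∀ i, MeasurableSet (A i)
  ne_top : ∀ i, μ (A i) ≠ ∞
  ne_zero : ∀ i, μ (A i) ≠ 0
  disjoint : Pairwise fun i j => Disjoint (A i) (A j)

theorem IsDisjointPosFamily.snoc {k : ℕ} {A : Fin k → Set Ω} (hA : IsDisjointPosFamily μ A)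
    {B : Set Ω} (hB : MeasurableSet B) (hBt : μ B ≠ ∞) (hB0 : μ B ≠ 0)
    (hAB : ∀ i, Disjoint (A i) B) :
    IsDisjointPosFamily μ (Fin.snoc A B : Fin (k + 1) → Set Ω) := by
  refine ⟨fun i => ?_, fun i => ?_, fun i => ?_, fun i j hij => ?_⟩
  · refine Fin.lastCases ?_ (fun i => ?_) i
    · simpa using hB
    · simpa using hA.measurableSet i
  · refine Fin.lastCases ?_ (fun i => ?_) i
    · simpa using hBt
    · simpa using hA.ne_top i
  · refine Fin.lastCases ?_ (fun i => ?_) i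
    · simpa using hB0
    · simpa using hA.ne_zero i
  · induction i using Fin.lastCases with
    | last =>
      induction j using Fin.lastCases with
      | last => exact absurd rfl hij
      | cast j => simpa using (hAB j).symm
    | cast i =>
      induction j using Fin.lastCases with
      | last => simpa using hAB i
      | cast j => simpa using hA.disjoint fun h => hij (by rw [h])

theorem IsDisjointPosFamily.update_inter {k : ℕ} {A : Fin k → Set Ω}
    (hA : IsDisjointPosFamily μ A) (i : Fin k) {B : Set Ω} (hB : MeasurableSet B)
    (h0 : μ (A i ∩ B) ≠ 0) : IsDisjointPosFamily μ (Function.update A i (A i ∩ B)) := by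
  have hsub : ∀ j, Function.update A i (A i ∩ B) j ⊆ A j := by
    intro j
    by_cases h : j = i
    · subst h
      simp
    · simp [h]
  refine ⟨fun j => ?_, fun j => ne_top_of_le_ne_top (hA.ne_top j) (measure_mono (hsub j)),
    fun j => ?_, fun j l hjl => (hA.disjoint hjl).mono (hsub j) (hsub l)⟩
  · by_cases h : j = i
    · subst h
      simpa using (hA.measurableSet j).inter hB
    · simpa [h] using hA.measurableSet j
  · by_cases h : j = i
    · subst h
      simpa using h0
    · simpa [h] using hA.ne_zero j

/-- For a disjoint family of maximal size, the indicators of its members span `Lᵖ`. -/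
theorem IsDisjointPosFamily.span_eq_top {k : ℕ} {A : Fin k → Set Ω}
    (hA : IsDisjointPosFamily μ A) (hp : p ≠ ∞)
    (hmax : ∀ A' : Fin (k + 1) → Set Ω, ¬ IsDisjointPosFamily μ A') :
    Submodule.span ℝ (Set.range fun i =>
      (indicatorConstLp p (hA.measurableSet i) (hA.ne_top i) (1 : ℝ) : Lp ℝ p μ)) = ⊤ := by
  classical
  set S := Submodule.span ℝ (Set.range fun i =>
      (indicatorConstLp p (hA.measurableSet i) (hA.ne_top i) (1 : ℝ) : Lp ℝ p μ)) with hS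
  have hfin : FiniteDimensional ℝ S := FiniteDimensional.span_of_finite ℝ (Set.finite_range _)
  rw [Submodule.eq_top_iff']
  -- The span is finite-dimensional, hence closed, so only multiples of indicators need checking.
  refine Lp.induction hp (fun f => f ∈ S) ?_ ?_ S.closed_of_finiteDimensional
  · intro c B hB hBt
    -- By maximality no part of `B` of positive measure lies outside the family, and `B` cuts no `A
    -- i` into two parts of positive measure. Hence `B` is, up to a null set, a union of members.
    have hout : μ (B \ ⋃ i, A i) = 0 := by
      by_contra h
      exact hmax _ (hA.snoc (hB.diff (MeasurableSet.iUnion hA.measurableSet))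
        (ne_top_of_le_ne_top hBt.ne (measure_mono Set.sdiff_subset)) h fun i =>
          Set.disjoint_sdiff_right.mono_left (Set.subset_iUnion A i))
    have hdich : ∀ i, μ (A i ∩ B) = 0 ∨ μ (A i \ B) = 0 := by
      intro i
      by_contra! h
      refine hmax _ ((hA.update_inter i hB h.1).snoc ((hA.measurableSet i).diff hB)
        (ne_top_of_le_ne_top (hA.ne_top i) (measure_mono Set.sdiff_subset)) h.2 fun j => ?_)
      by_cases hj : j = i
      · subst hj
        simp only [Function.update_self]
        exact Set.disjoint_sdiff_right.mono_left Set.inter_subset_right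
      · simp only [Function.update_of_ne hj]
        exact (hA.disjoint hj).mono_right Set.sdiff_subset
    have hrep : ((Lp.simpleFunc.indicatorConst p hB hBt.ne c : Lp.simpleFunc ℝ p μ) : Lp ℝ p μ) =
        ∑ i, (if μ (A i \ B) = 0 then c else 0) •
          (indicatorConstLp p (hA.measurableSet i) (hA.ne_top i) (1 : ℝ) : Lp ℝ p μ) := by
      rw [Lp.simpleFunc.coe_indicatorConst]
      apply Lp.ext
      have h1 : ∀ᵐ t ∂μ, t ∉ B \ ⋃ i, A i := measure_eq_zero_iff_ae_notMem.1 hout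
      have h2 : ∀ᵐ t ∂μ, ∀ i, (μ (A i \ B) = 0 → t ∉ A i \ B) ∧
          (μ (A i \ B) ≠ 0 → t ∉ A i ∩ B) := by
        rw [ae_all_iff]
        intro i
        by_cases h : μ (A i \ B) = 0
        · filter_upwards [measure_eq_zero_iff_ae_notMem.1 h] with t ht
          exact ⟨fun _ => ht, fun h' => absurd h h'⟩
        · filter_upwards [measure_eq_zero_iff_ae_notMem.1 ((hdich i).resolve_right h)] with t ht
          exact ⟨fun h' => absurd h' h, fun _ => ht⟩
      have h3 : ∀ᵐ t ∂μ, ∀ i, (indicatorConstLp p (hA.measurableSet i) (hA.ne_top i) (1 : ℝ) :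
          Lp ℝ p μ) t = (A i).indicator (fun _ => (1 : ℝ)) t := by
        rw [ae_all_iff]
        exact fun i => indicatorConstLp_coeFn
      filter_upwards [indicatorConstLp_coeFn (p := p) (hs := hB) (hμs := hBt.ne) (c := c),
        Lp_coeFn_sum_smul Finset.univ (fun i => if μ (A i \ B) = 0 then c else 0)
          (fun i => (indicatorConstLp p (hA.measurableSet i) (hA.ne_top i) (1 : ℝ) : Lp ℝ p μ)),
        h1, h2, h3] with t e1 e2 h1 h2 h3
      rw [e1, e2]
      simp only [h3]
      by_cases hex : ∃ i, t ∈ A i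
      · obtain ⟨i, hi⟩ := hex
        rw [Finset.sum_eq_single i]
        · rw [Set.indicator_of_mem hi, mul_one]
          split_ifs with h
          · exact Set.indicator_of_mem (by_contra fun hB' => (h2 i).1 h ⟨hi, hB'⟩) _
          · exact Set.indicator_of_notMem (fun hB' => (h2 i).2 h ⟨hi, hB'⟩) _
        · intro j _ hj
          rw [Set.indicator_of_notMem (Set.disjoint_left.1 (hA.disjoint hj.symm) hi), mul_zero]
        · simp
      · push Not at hex
        rw [Set.indicator_of_notMem fun hB' => h1 ⟨hB', by simpa using hex⟩]
        refine (Finset.sum_eq_zero fun i _ => ?_).symm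
        rw [Set.indicator_of_notMem (hex i), mul_zero]
    rw [hrep]
    exact S.sum_mem fun i _ => S.smul_mem _ (Submodule.subset_span ⟨i, rfl⟩)
  · intro f g hf hg _ h1 h2
    exact S.add_mem h1 h2

/-- If there is a family of size `k` but none of size `k + 1`, then `k` indicators span `Lᵖ`,
contradicting rank at least `k + 1`. -/
theorem exists_isDisjointPosFamily_of_le_rank (hp : p ≠ ∞) {N : ℕ}
    (hN : (N : Cardinal) ≤ Module.rank ℝ (Lp ℝ p μ)) :
    ∃ A : Fin N → Set Ω, IsDisjointPosFamily μ A := by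
  induction N with
  | zero => exact ⟨fun i => i.elim0, ⟨fun i => i.elim0, fun i => i.elim0, fun i => i.elim0,
      fun i => i.elim0⟩⟩
  | succ k ih =>
    obtain ⟨A, hA⟩ := ih (le_trans (by exact_mod_cast Nat.le_succ k) hN)
    by_contra! hmax
    have hspan := hA.span_eq_top hp hmax
    have h1 := rank_span_le (R := ℝ) (Set.range fun i =>
      (indicatorConstLp p (hA.measurableSet i) (hA.ne_top i) (1 : ℝ) : Lp ℝ p μ))
    rw [hspan, rank_top] at h1
    have h2 := hN.trans h1
    have hfin : Fintype (Set.range fun i =>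
      (indicatorConstLp p (hA.measurableSet i) (hA.ne_top i) (1 : ℝ) : Lp ℝ p μ)) :=
      Fintype.ofFinite _
    rw [Cardinal.mk_fintype, Nat.cast_le] at h2
    have h3 := Fintype.card_le_of_surjective _ (Set.rangeFactorization_surjective (f := fun i =>
      (indicatorConstLp p (hA.measurableSet i) (hA.ne_top i) (1 : ℝ) : Lp ℝ p μ)))
    rw [Fintype.card_fin] at h3
    omega

/-- The indicators are scaled to norm one; disjoint supports leave at most one nonzero term at
almost every point, so `p`-th powers of norms add. -/
theorem IsDisjointPosFamily.isIsometricBasis (hp : p ≠ ∞) {k : ℕ} {A : Fin k → Set Ω}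
    (hA : IsDisjointPosFamily μ A) :
    IsIsometricBasis p.toReal (fun i => (indicatorConstLp p (hA.measurableSet i) (hA.ne_top i)
      ((μ.real (A i))⁻¹ ^ p.toReal⁻¹) : Lp ℝ p μ)) := by
  have hp0 : p ≠ 0 := (lt_of_lt_of_le (by norm_num) (Fact.out : 1 ≤ p)).ne'
  have hr : p.toReal ≠ 0 := ENNReal.toReal_ne_zero.2 ⟨hp0, hp⟩
  intro c
  have hm : ∀ i, 0 < μ.real (A i) := fun i => ENNReal.toReal_pos (hA.ne_zero i) (hA.ne_top i)
  set w : Fin k → ℝ := fun i => (μ.real (A i))⁻¹ ^ p.toReal⁻¹ with hw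
  have hw0 : ∀ i, 0 ≤ w i := fun i => Real.rpow_nonneg (inv_nonneg.2 (hm i).le) _
  have hwr : ∀ i, w i ^ p.toReal = (μ.real (A i))⁻¹ := fun i =>
    Real.rpow_inv_rpow (inv_nonneg.2 (hm i).le) hr
  rw [Lp_norm_rpow_eq_integral hp0 hp]
  have h3 : ∀ᵐ t ∂μ, ∀ i, (indicatorConstLp p (hA.measurableSet i) (hA.ne_top i) (w i) :
      Lp ℝ p μ) t = (A i).indicator (fun _ => w i) t := by
    rw [ae_all_iff]
    exact fun i => indicatorConstLp_coeFn
  have h4 : (fun t => |(∑ i, c i • (indicatorConstLp p (hA.measurableSet i) (hA.ne_top i) (w i) :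
      Lp ℝ p μ) : Lp ℝ p μ) t| ^ p.toReal) =ᵐ[μ]
      fun t => ∑ i, (A i).indicator (fun _ => |c i| ^ p.toReal * (μ.real (A i))⁻¹) t := by
    filter_upwards [Lp_coeFn_sum_smul Finset.univ c (fun i =>
      (indicatorConstLp p (hA.measurableSet i) (hA.ne_top i) (w i) : Lp ℝ p μ)), h3] with t e h3
    rw [e]
    simp only [h3]
    by_cases hex : ∃ i, t ∈ A i
    · obtain ⟨i, hi⟩ := hex
      have hj : ∀ j, j ≠ i → t ∉ A j := fun j hj =>
        Set.disjoint_left.1 (hA.disjoint hj.symm) hi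
      rw [Finset.sum_eq_single i, Finset.sum_eq_single i, Set.indicator_of_mem hi,
        Set.indicator_of_mem hi, abs_mul, Real.mul_rpow (abs_nonneg _) (abs_nonneg _),
        abs_of_nonneg (hw0 i), hwr]
      · intro j _ h
        rw [Set.indicator_of_notMem (hj j h)]
      · simp
      · intro j _ h
        rw [Set.indicator_of_notMem (hj j h), mul_zero]
      · simp
    · push Not at hex
      simp [hex, Real.zero_rpow hr]
  rw [integral_congr_ae h4, integral_finsetSum]
  · refine Finset.sum_congr rfl fun i _ => ?_
    rw [integral_indicator_const _ (hA.measurableSet i), smul_eq_mul]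
    field_simp [(hm i).ne']
  · intro i _
    exact (integrable_indicator_iff (hA.measurableSet i)).2 (integrableOn_const (hA.ne_top i))

end DisjointSets

/-! ### The sequence spaces `ℓᵖ(ι)` -/

section SequenceSpace

variable {ι : Type*} {p : ℝ≥0∞}

theorem exists_finset_card_of_le_rank_lp {N : ℕ}
    (hN : (N : Cardinal) ≤ Module.rank ℝ (lp (fun _ : ι => ℝ) p)) :
    ∃ s : Finset ι, s.card = N := by
  rcases finite_or_infinite ι with hfin | hinf
  · have := Fintype.ofFinite ι
    have h1 : Module.rank ℝ (lp (fun _ : ι => ℝ) p) ≤ Module.rank ℝ (ι → ℝ) :=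
      LinearMap.rank_le_of_injective
        ({ toFun := fun f => f
           map_add' := fun _ _ => rfl
           map_smul' := fun _ _ => rfl } : lp (fun _ : ι => ℝ) p →ₗ[ℝ] (ι → ℝ))
        fun f g h => lp.ext h
    rw [rank_fun'] at h1
    have h2 := hN.trans h1
    rw [Nat.cast_le, ← Finset.card_univ] at h2
    obtain ⟨s, -, hs⟩ := Finset.exists_subset_card_eq h2
    exact ⟨s, hs⟩
  · exact Infinite.exists_subset_card_eq ι N

variable [Fact (1 ≤ p)]

theorem lp_isIsometricBasis [DecidableEq ι] (hp : p ≠ ∞) (s : Finset ι) :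
    IsIsometricBasis p.toReal (fun i : s => (lp.single p (i : ι) (1 : ℝ) :
      lp (fun _ : ι => ℝ) p)) := by
  have hp0 : 0 < p.toReal := ENNReal.toReal_pos (lt_of_lt_of_le (by norm_num)
    (Fact.out : 1 ≤ p)).ne' hp
  intro c
  have h := lp.norm_sum_single (E := fun _ : ι => ℝ) hp0
    (fun i => if h : i ∈ s then c ⟨i, h⟩ else 0) s
  rw [← Finset.sum_coe_sort s, ← Finset.sum_coe_sort s] at h
  simp only [Finset.coe_mem, dif_pos, Subtype.coe_eta, Real.norm_eq_abs] at h
  rw [← h]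
  congr 2
  refine Finset.sum_congr rfl fun i _ => ?_
  rw [← lp.single_smul, smul_eq_mul, mul_one]

theorem memLp_count_of_lp (hp : p ≠ ∞) (f : lp (fun _ : ι => ℝ) p) :
    letI : MeasurableSpace ι := ⊤
    MemLp f p (Measure.count : Measure ι) := by
  letI : MeasurableSpace ι := ⊤
  have hp0 : p ≠ 0 := (lt_of_lt_of_le (by norm_num) (Fact.out : 1 ≤ p)).ne'
  have hr : 0 < p.toReal := ENNReal.toReal_pos hp0 hp
  refine ⟨(measurable_from_top (f := (f : ι → ℝ))).aestronglyMeasurable, ?_⟩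
  rw [eLpNorm_lt_top_iff_lintegral_rpow_enorm_lt_top hp0 hp, lintegral_count]
  have h := ((lp.memℓp f).summable hr).tsum_ofReal_lt_top
  refine h.trans_eq' (tsum_congr fun i => ?_)
  rw [← ENNReal.ofReal_rpow_of_nonneg (norm_nonneg _) hr.le, ofReal_norm]

/-- `ℓᵖ(ι)` embeds isometrically into `Lᵖ` of the counting measure. -/
noncomputable def lpToLpCount (ι : Type*) (p : ℝ≥0∞) [Fact (1 ≤ p)] (hp : p ≠ ∞) :
    lp (fun _ : ι => ℝ) p →ₗᵢ[ℝ] @Lp ι ℝ ⊤ _ p (@Measure.count ι ⊤) :=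
  letI : MeasurableSpace ι := ⊤
  { toFun := fun f => (memLp_count_of_lp hp f).toLp f
    map_add' := fun _ _ => rfl
    map_smul' := fun _ _ => rfl
    norm_map' := by
      intro f
      have hp0 : p ≠ 0 := (lt_of_lt_of_le (by norm_num) (Fact.out : 1 ≤ p)).ne'
      have hr : 0 < p.toReal := ENNReal.toReal_pos hp0 hp
      change ‖(memLp_count_of_lp hp f).toLp f‖ = ‖f‖
      rw [Lp.norm_toLp, lp.norm_eq_tsum_rpow hr, eLpNorm_eq_lintegral_rpow_enorm_toReal hp0 hp,
        lintegral_count, ← ENNReal.toReal_rpow, ENNReal.tsum_toReal_eq]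
      · simp [← ENNReal.toReal_rpow]
      · intro i
        exact (ENNReal.rpow_lt_top_of_nonneg hr.le (by simp)).ne }

end SequenceSpace

/-! ### Matching the bounds -/

section Embedded

variable {Ω : Type*} [MeasurableSpace Ω] {μ : Measure Ω} {p : ℝ≥0∞} [Fact (1 ≤ p)]
  {X : Type*} [NormedAddCommGroup X] [NormedSpace ℝ X]

/-- The constant of a space between `ℓᵖ` of dimension `n` and `Lᵖ`, for `p ≤ 2`. -/
theorem upperModifiedNJ_eq_of_le_two (T : X →ₗᵢ[ℝ] Lp ℝ p μ) (hp2 : p ≤ 2) {n : ℕ} [NeZero n]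
    {e : Fin n → X} (he : IsIsometricBasis p.toReal e) :
    upperModifiedNJ n X = (n : ℝ) ^ (2 / p.toReal - 1) := by
  have hn : (0 : ℝ) < n := by exact_mod_cast Nat.pos_of_ne_zero (NeZero.ne n)
  have hr : 0 < p.toReal := ENNReal.toReal_pos (lt_of_lt_of_le (by norm_num)
    (Fact.out : 1 ≤ p)).ne' (lt_of_le_of_lt hp2 (by norm_num)).ne
  obtain ⟨x, hx, hxv⟩ := exists_njQuotient_eq_of_le_two hr he
  refine upperModifiedNJ_eq (Real.rpow_pos_of_pos hn _) (fun y hy => ?_) hx hxv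
  rw [← njQuotient_map T]
  exact Lp_njQuotient_le_of_le_two hp2 _ fun j => by rw [T.norm_map, hy]

/-- The constant of a space between `ℓᵖ` of dimension `2 ^ (n - 1)` and `Lᵖ`, for `p > 2`. -/
theorem upperModifiedNJ_eq_of_two_lt (T : X →ₗᵢ[ℝ] Lp ℝ p μ) (hp2 : 2 < p) (hp : p ≠ ∞) {n : ℕ}
    [NeZero n] {e : Fin (2 ^ (n - 1)) → X} (he : IsIsometricBasis p.toReal e) :
    upperModifiedNJ n X =
      (n : ℝ)⁻¹ * ((2 : ℝ) ^ (1 - (n : ℝ)) * ∑ k ∈ Finset.range (n / 2 + 1),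
        (n.choose k : ℝ) * ((n : ℝ) - 2 * k) ^ p.toReal) ^ (2 / p.toReal) := by
  have hn : (0 : ℝ) < n := by exact_mod_cast Nat.pos_of_ne_zero (NeZero.ne n)
  have hr : 0 < p.toReal := ENNReal.toReal_pos (lt_of_lt_of_le (by norm_num)
    (Fact.out : 1 ≤ p)).ne' hp
  have hc : Fintype.card ({j : Fin n // j ≠ 0} → ℤˣ) = 2 ^ (n - 1) := by
    rw [Fintype.card_fun, Fintype.card_units_int]
    simp [Fintype.card_subtype_compl]
  obtain ⟨x, hx, hxv⟩ :=
    exists_njQuotient_eq_of_two_lt hr (he.comp_equiv (Fintype.equivFinOfCardEq hc))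
  rw [← rademacherPowSum_one_div hr]
  refine upperModifiedNJ_eq (mul_pos (inv_pos.2 hn) (Real.rpow_pos_of_pos
    (div_pos (rademacherPowSum_one_pos n _) (by positivity)) _)) (fun y hy => ?_) hx hxv
  rw [← njQuotient_map T]
  exact Lp_njQuotient_le_of_two_le hp2.le hp _ fun j => by rw [T.norm_map, hy]

end Embedded

theorem exists_isIsometricBasis_Lp {Ω : Type*} [MeasurableSpace Ω] {μ : Measure Ω} {p : ℝ≥0∞}
    [Fact (1 ≤ p)] (hp : p ≠ ∞) {N : ℕ} (hN : (N : Cardinal) ≤ Module.rank ℝ (Lp ℝ p μ)) :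
    ∃ e : Fin N → Lp ℝ p μ, IsIsometricBasis p.toReal e := by
  obtain ⟨A, hA⟩ := exists_isDisjointPosFamily_of_le_rank hp hN
  exact ⟨_, hA.isIsometricBasis hp⟩

theorem exists_isIsometricBasis_lp {ι : Type*} {p : ℝ≥0∞} [Fact (1 ≤ p)] (hp : p ≠ ∞) {N : ℕ}
    (hN : (N : Cardinal) ≤ Module.rank ℝ (lp (fun _ : ι => ℝ) p)) :
    ∃ e : Fin N → lp (fun _ : ι => ℝ) p, IsIsometricBasis p.toReal e := by
  classical
  obtain ⟨s, hs⟩ := exists_finset_card_of_le_rank_lp hN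
  exact ⟨_, (lp_isIsometricBasis hp s).comp_equiv (s.equivFinOfCardEq hs).symm⟩

/-- Dimension is the cardinal `Module.rank`, so infinite-dimensional spaces satisfy the hypotheses;
`finrank` would be zero there. -/
theorem mainTheorem2 {Ω : Type*} [MeasurableSpace Ω] (μ : Measure Ω) (ι : Type*)
    (p : ℝ≥0∞) [Fact (1 ≤ p)] (hp : p ≠ ∞) (n : ℕ) [NeZero n] (hn : 2 ≤ n) :
    (p ≤ 2 →
      ((n : Cardinal) ≤ Module.rank ℝ (Lp ℝ p μ) →
        upperModifiedNJ n (Lp ℝ p μ) = (n : ℝ) ^ (2 / p.toReal - 1)) ∧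
      ((n : Cardinal) ≤ Module.rank ℝ (lp (fun _ : ι => ℝ) p) →
        upperModifiedNJ n (lp (fun _ : ι => ℝ) p) = (n : ℝ) ^ (2 / p.toReal - 1))) ∧
    (2 < p →
      (((2 ^ (n - 1) : ℕ) : Cardinal) ≤ Module.rank ℝ (Lp ℝ p μ) →
        upperModifiedNJ n (Lp ℝ p μ) =
          (n : ℝ)⁻¹ * ((2 : ℝ) ^ (1 - (n : ℝ)) * ∑ k ∈ Finset.range (n / 2 + 1),
            (n.choose k : ℝ) * ((n : ℝ) - 2 * k) ^ p.toReal) ^ (2 / p.toReal)) ∧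
      (((2 ^ (n - 1) : ℕ) : Cardinal) ≤ Module.rank ℝ (lp (fun _ : ι => ℝ) p) →
        upperModifiedNJ n (lp (fun _ : ι => ℝ) p) =
          (n : ℝ)⁻¹ * ((2 : ℝ) ^ (1 - (n : ℝ)) * ∑ k ∈ Finset.range (n / 2 + 1),
            (n.choose k : ℝ) * ((n : ℝ) - 2 * k) ^ p.toReal) ^ (2 / p.toReal))) := by
  -- The discrete σ-algebra on which `lpToLpCount` is defined.
  let : MeasurableSpace ι := ⊤
  refine ⟨fun hp2 => ⟨fun h => ?_, fun h => ?_⟩, fun hp2 => ⟨fun h => ?_, fun h => ?_⟩⟩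
  · obtain ⟨e, he⟩ := exists_isIsometricBasis_Lp hp h
    exact upperModifiedNJ_eq_of_le_two LinearIsometry.id hp2 he
  · obtain ⟨e, he⟩ := exists_isIsometricBasis_lp hp h
    exact upperModifiedNJ_eq_of_le_two (lpToLpCount ι p hp) hp2 he
  · obtain ⟨e, he⟩ := exists_isIsometricBasis_Lp hp h
    exact upperModifiedNJ_eq_of_two_lt LinearIsometry.id hp2 hp he
  · obtain ⟨e, he⟩ := exists_isIsometricBasis_lp hp h
    exact upperModifiedNJ_eq_of_two_lt (lpToLpCount ι p hp) hp2 hp he
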